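/- Let $(N_t)_{t\ge0}$ be a non-homogeneous Poisson process with locally integrable intensity $\lambda\ge0$ on $[0,\infty)$, cumulated intensity $\Lambda(t)=\int_0^t\lambda(x)\,dx$, and successive points $T_1,T_2,\dots$ Let $V_i=(V_i^{(1)},V_i^{(2)})$, $i\ge1$, be i.i.d. random vectors with values in $[0,\infty)^2$ and common distribution $\mu$, independent of $(N_t)_{t\ge0}$, and let $A_t=(A_t^{(1)},A_t^{(2)})=\sum_{k=1}^{N_t}V_k$. Let $(G_t)_{t\ge0}$ be a nonnegative increasing stochastic process, independent of $(A_t)_{t\ge0}$, let $F_{G_t}$ be the distribution function of $G_t$, let $p:[0,\infty)\to[0,1]$ be measurable and $q=1-p$. For $t\ge0$ and $L\ge 0$ set $$\phi_t(L)=\mathbb E\Big(F_{G_t}\big(L-A_t^{(2)}\big)\,e^{-\int_0^tA_s^{(1)}\,ds}\prod_{i=1}^{N_t}q(T_i)\Big).$$ For $u,s\ge0$ let $\tilde\mu(u,s)=\iint_{\mathbb R_+^2}e^{-uv_1-sv_2}\,\mu(dv_1,dv_2)$, and let $\tilde\mu_1,\tilde\mu_2$ be the Laplace transforms of the two marginals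 $\mu_1,\mu_2$ of $\mu$. For a function $f\ge0$ on $[0,\infty)$ write $\tilde f(s)=\int_0^\infty e^{-sL}f(L)\,dL\in[0,\infty]$, and for functions $f,g$ on $[0,\infty)$ write $(f*g)(t)=\int_0^tf(z)g(t-z)\,dz$. Then, for every $t\ge0$: 1. $\tilde\phi_t(s)=\tilde F_{G_t}(s)\,\tilde\nu_t(s)$ for all $s\ge0$, where $$\tilde\nu_t(s)=\exp\big(-\Lambda(t)+((q\lambda)*\tilde\mu(\cdot,s))(t)\big);$$ 2. there is exactly one finite measure $\nu_t$ on $[0,\infty)$ whose Laplace transform $\int_{[0,\infty)}e^{-sx}\,\nu_t(dx)$ equals $\tilde\nu_t(s)$ for all $s\ge0$, and $$\phi_t(L)=(F_{G_t}*\nu_t)(L)=\int_{[0,L]}F_{G_t}(L-x)\,\nu_t(dx)\quad\text{for all }L\ge0;$$ 3. if the two components of $V_1$ are independent, then $\tilde\nu_t(s)=\exp\big(-\Lambda(t)+a(t)\,\tilde\mu_2(s)\big)$ for all $s\ge0$, where $a(t)=(\tilde\mu_1*(q\lambda))(t)$. -/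

import Mathlib

open MeasureTheory ProbabilityTheory
open scoped NNReal ENNReal

noncomputable section

namespace ShockModel

variable {Ω : Type*} [MeasurableSpace Ω]

/-- `N` is (under `P`) a non-homogeneous Poisson process with intensity `lam x dx` on `[0, ∞)`:
it starts from `0`, its paths are a.s. nondecreasing and right-continuous, its increments are
independent, and `N t - N s` is Poisson distributed with mean `∫_s^t lam`. -/
structure IsPoissonProcess (P : Measure Ω) (N : ℝ≥0 → Ω → ℕ) (lam : ℝ → ℝ) : Prop where
  measurable : ∀ t, Measurable (N t)
  zero : ∀ᵐ ω ∂P, N 0 ω = 0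
  monotone : ∀ᵐ ω ∂P, Monotone fun t => N t ω
  rightCont : ∀ᵐ ω ∂P, ∀ t, ContinuousWithinAt (fun u => N u ω) (Set.Ici t) t
  indepIncrements : HasIndepIncrements N P
  law : ∀ s t : ℝ≥0, s ≤ t →
    HasLaw (fun ω => N t ω - N s ω) (poissonMeasure (∫ x in (s : ℝ)..t, lam x).toNNReal) P

/-- The arrival time of shock number `i + 1`, i.e. the first time at which `N` is at least `i + 1`.
It is only used for `i < N t ω`, when the set below is nonempty. -/
def arrival (N : ℝ≥0 → Ω → ℕ) (i : ℕ) (ω : Ω) : ℝ≥0 :=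
  sInf {s : ℝ≥0 | i + 1 ≤ N s ω}

/-- The bivariate compound process `A_t = (∑_{k ≤ N_t} V_k⁽¹⁾, ∑_{k ≤ N_t} V_k⁽²⁾)`; the increment
caused by shock number `i + 1` is `V i`. -/
def compound (N : ℝ≥0 → Ω → ℕ) (V : ℕ → Ω → ℝ × ℝ) (t : ℝ≥0) (ω : Ω) : ℝ × ℝ :=
  ∑ k ∈ Finset.range (N t ω), V k ω

/-- The standing assumptions: `lam` is the intensity of the shock process `N`, `p x` the probability
that a shock at time `x` is fatal, `V` the i.i.d. sequence of nonnegative increments with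
distribution `μ`, and `G` the nonnegative increasing intrinsic deterioration. -/
structure IsShockModel (P : Measure Ω) (N : ℝ≥0 → Ω → ℕ) (V : ℕ → Ω → ℝ × ℝ) (G : ℝ≥0 → Ω → ℝ)
    (lam p : ℝ → ℝ) (μ : Measure (ℝ × ℝ)) : Prop where
  lam_nonneg : ∀ x, 0 ≤ x → 0 ≤ lam x
  lam_integrable : ∀ t : ℝ, 0 ≤ t → IntervalIntegrable lam volume 0 t
  p_measurable : Measurable p
  p_mem : ∀ x, 0 ≤ x → p x ∈ Set.Icc (0 : ℝ) 1
  poisson : IsPoissonProcess P N lam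
  V_measurable : ∀ i, Measurable (V i)
  V_law : ∀ i, HasLaw (V i) μ P
  V_indep : iIndepFun V P
  V_nonneg : ∀ᵐ v ∂μ, 0 ≤ v.1 ∧ 0 ≤ v.2
  V_indep_N : IndepFun (fun ω i => V i ω) (fun ω t => N t ω) P
  G_measurable : ∀ t, Measurable (G t)
  G_nonneg : ∀ᵐ ω ∂P, ∀ t, 0 ≤ G t ω
  G_monotone : ∀ᵐ ω ∂P, Monotone fun t => G t ω
  A_indep_G : IndepFun (fun ω t => compound N V t ω) (fun ω t => G t ω) P

/-- `φ_t(L) = E (F_{G_t}(L - A_t⁽²⁾) exp(-∫_0^t A_s⁽¹⁾ ds) ∏_{i ≤ N_t} q(T_i))`, where `q = 1 - p`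
and `F_{G_t}` is the distribution function of `G_t`. -/
def phi (P : Measure Ω) (N : ℝ≥0 → Ω → ℕ) (V : ℕ → Ω → ℝ × ℝ) (G : ℝ≥0 → Ω → ℝ) (p : ℝ → ℝ)
    (t : ℝ≥0) (L : ℝ) : ℝ :=
  ∫ ω, cdf (P.map (G t)) (L - (compound N V t ω).2)
      * Real.exp (-∫ s in (0 : ℝ)..t, (compound N V s.toNNReal ω).1)
      * ∏ i ∈ Finset.range (N t ω), (1 - p (arrival N i ω)) ∂P

/-- Laplace transform `∫_0^∞ e^{-sx} f(x) dx` of a nonnegative function, with values in `[0, ∞]`. -/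
def laplaceFun (f : ℝ → ℝ) (s : ℝ) : ℝ≥0∞ :=
  ∫⁻ x in Set.Ici (0 : ℝ), ENNReal.ofReal (Real.exp (-(s * x)) * f x)

/-- Laplace transform `∫_{[0, ∞)} e^{-sx} ν(dx)` of a finite measure. -/
def laplaceMeasure (ν : Measure ℝ) (s : ℝ) : ℝ :=
  ∫ x in Set.Ici (0 : ℝ), Real.exp (-(s * x)) ∂ν

/-- Bivariate Laplace transform `∬_{[0, ∞)²} e^{-u v₁ - s v₂} μ(dv₁, dv₂)`. -/
def laplaceMeasure₂ (μ : Measure (ℝ × ℝ)) (u s : ℝ) : ℝ :=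
  ∫ v in Set.Ici (0 : ℝ) ×ˢ Set.Ici (0 : ℝ), Real.exp (-(u * v.1) - s * v.2) ∂μ

/-- Convolution `∫_0^t f(z) g(t - z) dz` of functions on `[0, ∞)`. -/
def convFun (f g : ℝ → ℝ) (t : ℝ) : ℝ :=
  ∫ z in (0 : ℝ)..t, f z * g (t - z)

/-- Convolution `∫_{[0, L]} F(L - x) ν(dx)` of a function with a measure on `[0, ∞)`. -/
def convMeasure (F : ℝ → ℝ) (ν : Measure ℝ) (L : ℝ) : ℝ :=
  ∫ x in Set.Icc 0 L, F (L - x) ∂ν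

/-- The cumulated intensity `Λ(t) = ∫_0^t lam`. -/
def cumIntensity (lam : ℝ → ℝ) (t : ℝ) : ℝ :=
  ∫ x in (0 : ℝ)..t, lam x

/-- The function `(qλ)(x) = q(x) λ(x)`, `q = 1 - p`. -/
def qlam (lam p : ℝ → ℝ) (x : ℝ) : ℝ :=
  (1 - p x) * lam x

/-- `exp(-Λ(t) + ((qλ) * μ̃(·, s))(t))`. -/
def nuTilde (lam p : ℝ → ℝ) (μ : Measure (ℝ × ℝ)) (t s : ℝ) : ℝ :=
  Real.exp (-cumIntensity lam t + convFun (qlam lam p) (fun u => laplaceMeasure₂ μ u s) t)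

/-- `a(t) = (μ̃₁ * (qλ))(t)`, with `μ₁` the first marginal of `μ`. -/
def aFun (lam p : ℝ → ℝ) (μ : Measure (ℝ × ℝ)) (t : ℝ) : ℝ :=
  convFun (laplaceMeasure (μ.map Prod.fst)) (qlam lam p) t

/-- `ν` is a finite measure carried by `[0, ∞)` whose Laplace transform is `f` on `[0, ∞)`. -/
structure HasLaplaceTransform (ν : Measure ℝ) (f : ℝ → ℝ) : Prop where
  finite : IsFiniteMeasure ν
  support : ν (Set.Iio 0) = 0
  eq : ∀ s, 0 ≤ s → laplaceMeasure ν s = f s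

end ShockModel

end

namespace ShockModel

/-! ### Laplace transforms of measures on the half-line -/

section Laplace

/-! On almost every path, each shock contributes its mark from its arrival time up to $t$, so
$\int_0^t A_s^{(1)}ds=\sum_{i\le N_t}(t-T_i)V_i^{(1)}$ and the weight in $\phi_t$ is the product
over shocks of $q(T_i)e^{-(t-T_i)V_i^{(1)}}$. Take for $\nu_t$ the law of $A_t^{(2)}$ under the
measure whose density is this weight (`shockMeasure`). Then $\phi_t(L)=\int F_{G_t}(L-x)\,\nu_t(dx)$
is a change of variables, and the factorization of $\tilde\phi_t$ is Tonelli plus translation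
invariance.

It remains to compute the Laplace transform of $\nu_t$. The factor $e^{-sA_t^{(2)}}$ also splits
over the shocks. Averaging over the marks, which are i.i.d. and independent of $N$
(`lintegral_prod_marks`), leaves $\mathbb E\prod_{i\le N_t}h(T_i)$ with $h(x)=q(x)\tilde\mu(t-x,s)$.
The generating functional of the Poisson process (`integral_prod_eq`) gives
$\exp\int_0^t(h-1)\lambda$, which is $\tilde\nu_t(s)$.

That functional is derived from the independent Poisson increments alone. It is explicit for
functions constant on the cells of a grid. Both sides are 1-Lipschitz in $h$ for the
$L^1(\lambda\,dx)$ distance, the left side by Campbell's formula, so the identity extends to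
continuous and then to measurable $h$ with values in $[0,1]$.

Uniqueness of $\nu_t$ is a Hausdorff moment argument: under $y=e^{-x}$ the Laplace transform at
integers becomes the moments of a measure on $[0,1]$. -/

lemma restrict_Ici_eq_self {ν : Measure ℝ} (h : ν (Set.Iio 0) = 0) :
    ν.restrict (Set.Ici 0) = ν := by
  refine Measure.restrict_eq_self_of_ae_mem ?_
  rw [ae_iff]
  simpa [← Set.Iio_def] using h

lemma ae_nonneg_of_measure_Iio {ν : Measure ℝ} (h : ν (Set.Iio 0) = 0) : ∀ᵐ x ∂ν, 0 ≤ x := by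
  rw [ae_iff]
  simpa [← Set.Iio_def] using h

lemma integrable_polynomial_exp_neg {ν : Measure ℝ} [IsFiniteMeasure ν]
    (hν : ν (Set.Iio 0) = 0) (k : ℕ) (c : ℝ) :
    Integrable (fun x => c * Real.exp (-x) ^ k) ν := by
  refine Integrable.of_bound (by fun_prop) |c| ?_
  filter_upwards [ae_nonneg_of_measure_Iio hν] with x hx
  have h1 : Real.exp (-x) ≤ 1 := Real.exp_le_one_iff.2 (by linarith)
  have h2 : Real.exp (-x) ^ k ≤ 1 := pow_le_one₀ (Real.exp_nonneg _) h1
  rw [Real.norm_eq_abs, abs_mul, abs_of_nonneg (a := Real.exp (-x) ^ k) (by positivity)]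
  exact mul_le_of_le_one_right (abs_nonneg _) h2

/-- A finite measure on `[0, ∞)` is determined by its Laplace transform at the integers. -/
theorem measure_ext_of_laplaceMeasure_eq {ν₁ ν₂ : Measure ℝ} [IsFiniteMeasure ν₁]
    [IsFiniteMeasure ν₂] (h₁ : ν₁ (Set.Iio 0) = 0) (h₂ : ν₂ (Set.Iio 0) = 0)
    (h : ∀ k : ℕ, laplaceMeasure ν₁ k = laplaceMeasure ν₂ k) : ν₁ = ν₂ := by
  -- The image measures live on $[0,1]$ and have the same moments there, so Weierstrass
  -- approximation identifies their integrals against bounded continuous functions; $-\log$ then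
  -- undoes the substitution.
  have key : ν₁.map (fun x => Real.exp (-x)) = ν₂.map (fun x => Real.exp (-x)) := by
    refine ext_of_forall_integral_eq_of_IsFiniteMeasure fun f => ?_
    have hm : Measurable fun x : ℝ => Real.exp (-x) := by fun_prop
    rw [integral_map hm.aemeasurable f.continuous.aestronglyMeasurable,
      integral_map hm.aemeasurable f.continuous.aestronglyMeasurable]
    have hpoly : ∀ p : Polynomial ℝ,
        ∫ x, p.eval (Real.exp (-x)) ∂ν₁ = ∫ x, p.eval (Real.exp (-x)) ∂ν₂ := by
      intro p
      simp_rw [Polynomial.eval_eq_sum_range]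
      rw [integral_finsetSum _ fun i _ => integrable_polynomial_exp_neg h₁ i _,
        integral_finsetSum _ fun i _ => integrable_polynomial_exp_neg h₂ i _]
      refine Finset.sum_congr rfl fun k _ => ?_
      rw [integral_const_mul, integral_const_mul]
      have := h k
      simp only [laplaceMeasure, restrict_Ici_eq_self h₁, restrict_Ici_eq_self h₂] at this
      simp_rw [← Real.exp_nat_mul, mul_neg, this]
    have hint : ∀ {ν : Measure ℝ} [IsFiniteMeasure ν], ν (Set.Iio 0) = 0 →
        ∀ p : Polynomial ℝ, Integrable (fun x => p.eval (Real.exp (-x))) ν := by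
      intro ν _ hν p
      simp_rw [Polynomial.eval_eq_sum_range]
      exact integrable_finsetSum _ fun i _ => integrable_polynomial_exp_neg hν i _
    have hintf : ∀ {ν : Measure ℝ} [IsFiniteMeasure ν],
        Integrable (fun x => f (Real.exp (-x))) ν := by
      intro ν _
      exact Integrable.of_bound (by fun_prop) ‖f‖ (ae_of_all _ fun x => f.norm_coe_le_norm _)
    have hclose : ∀ {ν : Measure ℝ} [IsFiniteMeasure ν], ν (Set.Iio 0) = 0 →
        ∀ p : Polynomial ℝ, ∀ ε : ℝ, (∀ x ∈ Set.Icc (0 : ℝ) 1, |p.eval x - f x| < ε) →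
        |∫ x, p.eval (Real.exp (-x)) ∂ν - ∫ x, f (Real.exp (-x)) ∂ν| ≤ ε * ν.real Set.univ := by
      intro ν _ hν p ε hp
      rw [← integral_sub (hint hν p) (hintf (ν := ν))]
      rw [← Real.norm_eq_abs]
      refine norm_integral_le_of_norm_le_const ?_
      filter_upwards [ae_nonneg_of_measure_Iio hν] with x hx
      exact (hp _ ⟨Real.exp_nonneg _, Real.exp_le_one_iff.2 (by linarith)⟩).le
    refine eq_of_forall_dist_le fun δ hδ => ?_
    -- The summand 1 keeps `C` positive when both measures vanish.
    set C := ν₁.real Set.univ + ν₂.real Set.univ + 1 with hC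
    have hCpos : 0 < C := by positivity
    obtain ⟨p, hp⟩ := exists_polynomial_near_of_continuousOn 0 1 f f.continuous.continuousOn
      (δ / C) (by positivity)
    have e1 := hclose h₁ p _ hp
    have e2 := hclose h₂ p _ hp
    rw [hpoly p] at e1
    have e3 : δ / C * ν₁.real Set.univ + δ / C * ν₂.real Set.univ ≤ δ := by
      calc _ = δ / C * (C - 1) := by rw [hC]; ring
        _ ≤ δ / C * C := by gcongr; linarith
        _ = δ := by field_simp
    rw [Real.dist_eq]
    rw [abs_le] at *
    constructor <;> linarith [e1.1, e1.2, e2.1, e2.2]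
  have hm : Measurable fun x : ℝ => Real.exp (-x) := by fun_prop
  have hl : Measurable fun y : ℝ => -Real.log y := by fun_prop
  have := congrArg (Measure.map fun y : ℝ => -Real.log y) key
  rwa [Measure.map_map hl hm, Measure.map_map hl hm,
    show (fun y : ℝ => -Real.log y) ∘ (fun x => Real.exp (-x)) = id from by ext; simp,
    Measure.map_id, Measure.map_id] at this

lemma laplaceFun_eq_lintegral {F : ℝ → ℝ} (h0 : ∀ x < 0, F x = 0) (s : ℝ) :
    laplaceFun F s = ∫⁻ x, ENNReal.ofReal (Real.exp (-(s * x)) * F x) := by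
  rw [laplaceFun, ← lintegral_indicator measurableSet_Ici]
  refine lintegral_congr fun x => ?_
  by_cases hx : 0 ≤ x
  · simp [Set.indicator, hx]
  · simp [Set.indicator, hx, h0 x (not_le.1 hx)]

/-- The Laplace transform turns convolution of a function with a measure into a product. -/
theorem laplaceFun_convolution {F : ℝ → ℝ} (hF : Measurable F) (hF0 : ∀ x, 0 ≤ F x)
    (hFneg : ∀ x < 0, F x = 0) (hF1 : ∀ x, F x ≤ 1) {ν : Measure ℝ} [IsFiniteMeasure ν]
    (hν : ν (Set.Iio 0) = 0) {s : ℝ} (hs : 0 ≤ s) {φ : ℝ → ℝ}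
    (hφ : ∀ L, 0 ≤ L → φ L = ∫ x, F (L - x) ∂ν) :
    laplaceFun φ s = laplaceFun F s * ENNReal.ofReal (laplaceMeasure ν s) := by
  have hkey : ∀ L, 0 ≤ L → ENNReal.ofReal (Real.exp (-(s * L)) * φ L)
      = ∫⁻ x, ENNReal.ofReal (Real.exp (-(s * L)) * F (L - x)) ∂ν := by
    intro L hL
    rw [hφ L hL, ← integral_const_mul, ofReal_integral_eq_lintegral_ofReal]
    · refine Integrable.const_mul ?_ _
      refine Integrable.of_bound (hF.comp (by fun_prop)).aestronglyMeasurable 1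
        (ae_of_all _ fun x => ?_)
      rw [Real.norm_eq_abs, abs_of_nonneg (hF0 _)]
      exact hF1 _
    · exact ae_of_all _ fun x => mul_nonneg (Real.exp_nonneg _) (hF0 _)
  have hmeas : Measurable fun z : ℝ × ℝ =>
      ENNReal.ofReal (Real.exp (-(s * z.1)) * F (z.1 - z.2)) := by fun_prop
  calc laplaceFun φ s
      = ∫⁻ L in Set.Ici (0 : ℝ), ∫⁻ x, ENNReal.ofReal (Real.exp (-(s * L)) * F (L - x)) ∂ν :=
        setLIntegral_congr_fun measurableSet_Ici fun L hL => hkey L hL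
    _ = ∫⁻ x, (∫⁻ L in Set.Ici (0 : ℝ), ENNReal.ofReal (Real.exp (-(s * L)) * F (L - x))) ∂ν :=
        lintegral_lintegral_swap hmeas.aemeasurable
    _ = ∫⁻ x, laplaceFun F s * ENNReal.ofReal (Real.exp (-(s * x))) ∂ν := by
        refine lintegral_congr_ae ?_
        filter_upwards [ae_nonneg_of_measure_Iio hν] with x hx
        rw [laplaceFun_eq_lintegral hFneg]
        -- For $x\ge0$ the integrand vanishes at negative $L$, so the half-line may be replaced by
        -- the whole line, where translation by $x$ is available.
        have : ∫⁻ L in Set.Ici (0 : ℝ), ENNReal.ofReal (Real.exp (-(s * L)) * F (L - x))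
            = ∫⁻ L, ENNReal.ofReal (Real.exp (-(s * L)) * F (L - x)) := by
          rw [← lintegral_indicator measurableSet_Ici]
          refine lintegral_congr fun L => ?_
          by_cases hL : 0 ≤ L
          · simp [Set.indicator, hL]
          · simp [Set.indicator, hL, hFneg (L - x) (by linarith [not_le.1 hL])]
        rw [this, ← lintegral_add_right_eq_self _ x, ← lintegral_mul_const _ (by fun_prop)]
        refine lintegral_congr fun L => ?_
        rw [← ENNReal.ofReal_mul (mul_nonneg (Real.exp_nonneg _) (hF0 _)), add_sub_cancel_right,
          mul_right_comm, ← Real.exp_add]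
        ring_nf
    _ = _ := by
        rw [lintegral_const_mul _ (by fun_prop), laplaceMeasure, restrict_Ici_eq_self hν,
          ofReal_integral_eq_lintegral_ofReal]
        · refine Integrable.of_bound (by fun_prop) 1 ?_
          filter_upwards [ae_nonneg_of_measure_Iio hν] with x hx
          rw [Real.norm_eq_abs, abs_of_nonneg (Real.exp_nonneg _)]
          exact Real.exp_le_one_iff.2 (by nlinarith)
        · exact ae_of_all _ fun x => Real.exp_nonneg _

lemma laplaceMeasure₂_eq_mul {μ : Measure (ℝ × ℝ)}
    (h : IndepFun (Prod.fst : ℝ × ℝ → ℝ) Prod.snd μ) (u s : ℝ) :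
    laplaceMeasure₂ μ u s
      = laplaceMeasure (μ.map Prod.fst) u * laplaceMeasure (μ.map Prod.snd) s := by
  have hm : ∀ c : ℝ, Measurable ((Set.Ici (0 : ℝ)).indicator fun x => Real.exp (-(c * x))) :=
    fun c => Measurable.indicator (by fun_prop) measurableSet_Ici
  have hi := (h.comp (hm u) (hm s)).integral_mul_eq_mul_integral
    ((hm u).comp measurable_fst).aestronglyMeasurable
    ((hm s).comp measurable_snd).aestronglyMeasurable
  rw [laplaceMeasure, laplaceMeasure, laplaceMeasure₂,
    ← integral_indicator measurableSet_Ici, ← integral_indicator measurableSet_Ici,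
    integral_map measurable_fst.aemeasurable (hm u).aestronglyMeasurable,
    integral_map measurable_snd.aemeasurable (hm s).aestronglyMeasurable,
    ← integral_indicator (measurableSet_Ici.prod measurableSet_Ici)]
  refine Eq.trans (integral_congr_ae (ae_of_all _ fun v => ?_)) hi
  by_cases h1 : 0 ≤ v.1 <;> by_cases h2 : 0 ≤ v.2 <;>
    simp [Set.indicator, Prod.le_def, h1, h2, ← Real.exp_add, sub_eq_add_neg]

lemma nuTilde_eq_of_indepFun {μ : Measure (ℝ × ℝ)}
    (h : IndepFun (Prod.fst : ℝ × ℝ → ℝ) Prod.snd μ) (lam p : ℝ → ℝ) (t s : ℝ) :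
    nuTilde lam p μ t s = Real.exp (-cumIntensity lam t
      + aFun lam p μ t * laplaceMeasure (μ.map Prod.snd) s) := by
  have : convFun (qlam lam p) (fun u => laplaceMeasure₂ μ u s) t
      = aFun lam p μ t * laplaceMeasure (μ.map Prod.snd) s := by
    simp only [convFun, aFun, laplaceMeasure₂_eq_mul h]
    rw [← intervalIntegral.integral_mul_const]
    -- The substitution $z\mapsto t-z$ reconciles the two orders of convolution used in `nuTilde`
    -- and `aFun`.
    have := intervalIntegral.integral_comp_sub_left (a := 0) (b := t)
      (fun z => qlam lam p z * (laplaceMeasure (μ.map Prod.fst) (t - z)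
        * laplaceMeasure (μ.map Prod.snd) s)) t
    simp only [sub_self, sub_zero, sub_sub_cancel] at this
    rw [← this]
    refine intervalIntegral.integral_congr fun z _ => ?_
    ring
  rw [nuTilde, this]

end Laplace

/-! ### Arrival times along a path -/

section Path

variable {Ω : Type*} {N : ℝ≥0 → Ω → ℕ} {ω : Ω} {t : ℝ≥0} {i : ℕ}

lemma arrival_le_of_lt {s : ℝ≥0} (h : i < N s ω) : arrival N i ω ≤ s :=
  csInf_le (OrderBot.bddBelow _) h

/-- The infimum is attained: an integer-valued right-continuous path is constant just to the right
of the arrival time, and times with at least `i + 1` shocks occur arbitrarily close to it. -/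
lemma lt_apply_arrival (hr : ∀ t, ContinuousWithinAt (fun u => N u ω) (Set.Ici t) t)
    (hi : i < N t ω) : i < N (arrival N i ω) ω := by
  have hev : ∀ᶠ u in nhdsWithin (arrival N i ω) (Set.Ici (arrival N i ω)),
      N u ω = N (arrival N i ω) ω := by
    have := hr (arrival N i ω)
    rwa [ContinuousWithinAt, nhds_discrete, Filter.tendsto_pure] at this
  obtain ⟨u, hu, hsub⟩ := mem_nhdsGE_iff_exists_Ico_subset.1 hev
  obtain ⟨s, hs, hsu⟩ := exists_lt_of_csInf_lt (s := {s : ℝ≥0 | i + 1 ≤ N s ω}) ⟨t, hi⟩ hu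
  have : N s ω = N (arrival N i ω) ω := hsub ⟨arrival_le_of_lt hs, hsu⟩
  rw [← this]
  exact hs

lemma arrival_le_iff (hm : Monotone fun t => N t ω)
    (hr : ∀ t, ContinuousWithinAt (fun u => N u ω) (Set.Ici t) t)
    (hi : i < N t ω) {s : ℝ≥0} : arrival N i ω ≤ s ↔ i < N s ω :=
  ⟨fun h => (lt_apply_arrival hr hi).trans_le (hm h), arrival_le_of_lt⟩

/-- The arrival time of shock number `i + 1`, truncated at `t`, as a measurable function of the
path of the counting process. -/
noncomputable def truncArrival (t : ℝ≥0) (i : ℕ) (n : ℝ≥0 → ℕ) : ℝ≥0 :=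
  ⨅ k : ℕ, if i < n (TopologicalSpace.denseSeq ℝ≥0 k) then
    min (TopologicalSpace.denseSeq ℝ≥0 k) t else t

lemma measurable_truncArrival (t : ℝ≥0) (i : ℕ) : Measurable (truncArrival t i) := by
  refine Measurable.iInf fun k => ?_
  refine Measurable.ite ?_ measurable_const measurable_const
  exact measurableSet_lt measurable_const (measurable_pi_apply _)

lemma truncArrival_le (t : ℝ≥0) (i : ℕ) (n : ℝ≥0 → ℕ) : truncArrival t i n ≤ t := by
  refine (ciInf_le (OrderBot.bddBelow _) 0).trans ?_
  split_ifs <;> simp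

/-- Only countably many times enter `truncArrival`, which makes it measurable for the product
σ-algebra on paths. Nothing is lost, since for a monotone path some time of the dense sequence lies
between a time with more than `i` shocks and any later bound. -/
lemma truncArrival_eq (hm : Monotone fun t => N t ω) (hi : i < N t ω) :
    truncArrival t i (fun s => N s ω) = arrival N i ω := by
  have hle : arrival N i ω ≤ t := arrival_le_of_lt hi
  refine le_antisymm ?_ (le_ciInf fun k => ?_)
  · refine le_of_forall_gt fun c hc => ?_
    rcases lt_or_ge t c with htc | hct
    · exact (truncArrival_le _ _ _).trans_lt htc
    · obtain ⟨s, hs, hsc⟩ := exists_lt_of_csInf_lt (s := {s : ℝ≥0 | i + 1 ≤ N s ω}) ⟨t, hi⟩ hc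
      obtain ⟨k, hk⟩ :=
        (TopologicalSpace.denseRange_denseSeq ℝ≥0).exists_mem_open isOpen_Ioo
          (Set.nonempty_Ioo.2 hsc)
      refine (ciInf_le (OrderBot.bddBelow _) k).trans_lt ?_
      rw [if_pos (lt_of_lt_of_le hs (hm hk.1.le))]
      exact (min_le_left _ _).trans_lt hk.2
  · split_ifs with h
    · exact le_min (arrival_le_of_lt h) hle
    · exact hle

lemma integral_indicator_arrival {a t : ℝ≥0} (h : a ≤ t) (c : ℝ) :
    ∫ s in (0 : ℝ)..t, (if a ≤ s.toNNReal then c else 0) = c * (t - a) := by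
  have : ∀ s ∈ Set.Ioc (0 : ℝ) t, (if a ≤ s.toNNReal then c else 0)
      = (Set.Ici (a : ℝ)).indicator (fun _ => c) s := by
    intro s hs
    simp only [Set.indicator, Set.mem_Ici, Real.le_toNNReal_iff_coe_le hs.1.le]
  rw [intervalIntegral.integral_of_le t.coe_nonneg, setIntegral_congr_fun measurableSet_Ioc this,
    setIntegral_indicator measurableSet_Ici, setIntegral_const, smul_eq_mul, mul_comm]
  congr 1
  -- An arrival at time 0 makes the intersection $(0,t]$ instead of $[a,t]$; squeezing between
  -- $(a,t]$ and $[a,t]$ covers both cases.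
  have h1 : volume (Set.Ioc (0 : ℝ) t ∩ Set.Ici (a : ℝ)) = ENNReal.ofReal (t - a) := by
    refine le_antisymm ?_ ?_
    · rw [← Real.volume_Icc]
      exact measure_mono fun x hx => ⟨hx.2, hx.1.2⟩
    · rw [← Real.volume_Ioc]
      exact measure_mono fun x hx => ⟨⟨a.coe_nonneg.trans_lt hx.1, hx.2⟩, hx.1.le⟩
  rw [measureReal_def, h1, ENNReal.toReal_ofReal (sub_nonneg.2 (by exact_mod_cast h))]

lemma integral_compound_fst (hm : Monotone fun t => N t ω)
    (hr : ∀ t, ContinuousWithinAt (fun u => N u ω) (Set.Ici t) t) (V : ℕ → Ω → ℝ × ℝ) :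
    ∫ s in (0 : ℝ)..t, (compound N V s.toNNReal ω).1
      = ∑ k ∈ Finset.range (N t ω), (V k ω).1 * (t - arrival N k ω) := by
  have h1 : ∀ s ∈ Set.uIcc (0 : ℝ) t, (compound N V s.toNNReal ω).1
      = ∑ k ∈ Finset.range (N t ω), if arrival N k ω ≤ s.toNNReal then (V k ω).1 else 0 := by
    intro s hs
    rw [Set.uIcc_of_le t.coe_nonneg] at hs
    have hst : s.toNNReal ≤ t := Real.toNNReal_le_iff_le_coe.2 hs.2
    rw [compound, Prod.fst_sum, ← Finset.sum_filter]
    refine Finset.sum_congr ?_ fun _ _ => rfl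
    ext k
    simp only [Finset.mem_range, Finset.mem_filter]
    refine ⟨fun h => ⟨h.trans_le (hm hst), arrival_le_of_lt h⟩, fun h => ?_⟩
    exact (arrival_le_iff hm hr h.1).1 h.2
  rw [intervalIntegral.integral_congr h1, intervalIntegral.integral_finsetSum]
  · refine Finset.sum_congr rfl fun k hk => ?_
    exact integral_indicator_arrival (arrival_le_of_lt (Finset.mem_range.1 hk)) _
  · intro k _
    rw [intervalIntegrable_iff, Set.uIoc_of_le t.coe_nonneg]
    refine Integrable.of_bound (Measurable.aestronglyMeasurable ?_) |(V k ω).1|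
      (ae_of_all _ fun s => ?_)
    · exact Measurable.ite (measurableSet_le measurable_const measurable_real_toNNReal)
        measurable_const measurable_const
    · split_ifs <;> simp

end Path

/-! ### Poisson distribution -/

section PoissonLaw

lemma integral_pow_poissonMeasure (r : ℝ≥0) (z : ℝ) :
    ∫ n, z ^ n ∂(poissonMeasure r) = Real.exp ((z - 1) * r) := by
  rw [integral_poissonMeasure]
  have h := (NormedSpace.expSeries_div_hasSum_exp ((r : ℝ) * z)).mul_left (Real.exp (-r))
  rw [← Real.exp_eq_exp_ℝ, ← Real.exp_add] at h
  rw [show (z - 1) * r = -(r : ℝ) + r * z by ring, ← h.tsum_eq]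
  refine tsum_congr fun n => ?_
  rw [smul_eq_mul, mul_pow]
  ring

lemma lintegral_natCast_poissonMeasure (r : ℝ≥0) :
    ∫⁻ n, (n : ℝ≥0∞) ∂(poissonMeasure r) = r := by
  have h : HasSum (fun n : ℕ => Real.exp (-r) * r ^ n / (n.factorial : ℝ) * (n : ℝ)) (r : ℝ) := by
    -- The term $n=0$ vanishes, and the shifted series is $r$ times the total mass of the Poisson
    -- law.
    rw [← hasSum_nat_add_iff' 1]
    have := (hasSum_one_poissonMeasure r).mul_left (r : ℝ)
    simp only [Finset.range_one, Finset.sum_singleton, Nat.cast_zero, mul_zero, sub_zero]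
    rw [mul_one] at this
    refine (congrArg (fun f : ℕ → ℝ => HasSum f (r : ℝ)) (funext fun n => ?_)).mpr this
    rw [Nat.factorial_succ]
    push_cast
    field_simp
    ring
  have hint : Integrable (fun n : ℕ => (n : ℝ)) (poissonMeasure r) := by
    rw [integrable_poissonMeasure_iff]
    simpa using h.summable
  have h2 := ofReal_integral_eq_lintegral_ofReal hint (ae_of_all _ fun n => Nat.cast_nonneg n)
  rw [integral_poissonMeasure] at h2
  simp only [smul_eq_mul, h.tsum_eq, ENNReal.ofReal_natCast, ENNReal.ofReal_coe_nnreal] at h2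
  exact h2.symm

lemma tsum_measure_lt_eq_lintegral {Ω : Type*} [MeasurableSpace Ω] (P : Measure Ω) {X : Ω → ℕ}
    (hX : Measurable X) : ∑' i : ℕ, P {ω | i < X ω} = ∫⁻ ω, (X ω : ℝ≥0∞) ∂P := by
  have hms : ∀ i, MeasurableSet {ω | i < X ω} := fun i => measurableSet_lt measurable_const hX
  have : ∀ ω, (X ω : ℝ≥0∞) = ∑' i : ℕ, {ω | i < X ω}.indicator (fun _ => (1 : ℝ≥0∞)) ω := by
    intro ω
    rw [tsum_eq_sum (s := Finset.range (X ω)) (by intro i hi; simpa using hi)]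
    rw [Finset.sum_congr rfl (g := fun _ => (1 : ℝ≥0∞)) (by intro i hi; simpa using hi)]
    simp
  simp_rw [this]
  rw [lintegral_tsum fun i => (measurable_const.indicator (hms i)).aemeasurable]
  refine tsum_congr fun i => ?_
  rw [lintegral_indicator_const (hms i), one_mul]

end PoissonLaw

/-! ### Lipschitz estimates for products and exponentials -/

/-- Factors are exchanged one at a time, each exchange being multiplied by numbers in $[0,1]$. -/
lemma abs_prod_sub_prod_le_sum {a b : ℕ → ℝ} (n : ℕ) (ha : ∀ i < n, a i ∈ Set.Icc (0 : ℝ) 1)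
    (hb : ∀ i < n, b i ∈ Set.Icc (0 : ℝ) 1) :
    |∏ i ∈ Finset.range n, a i - ∏ i ∈ Finset.range n, b i|
      ≤ ∑ i ∈ Finset.range n, |a i - b i| := by
  induction n with
  | zero => simp
  | succ n ih =>
    have ih := ih (fun i hi => ha i (by lia)) (fun i hi => hb i (by lia))
    rw [Finset.prod_range_succ, Finset.prod_range_succ, Finset.sum_range_succ]
    set x := ∏ i ∈ Finset.range n, a i
    set y := ∏ i ∈ Finset.range n, b i
    have hy0 : 0 ≤ y := Finset.prod_nonneg fun i hi => (hb i (by simp at hi; lia)).1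
    have hy1 : y ≤ 1 := Finset.prod_le_one (fun i hi => (hb i (by simp at hi; lia)).1)
      fun i hi => (hb i (by simp at hi; lia)).2
    obtain ⟨hA0, hA1⟩ := ha n (by lia)
    calc |x * a n - y * b n| = |(x - y) * a n + y * (a n - b n)| := by ring_nf
      _ ≤ |x - y| * a n + y * |a n - b n| := by
        refine (abs_add_le _ _).trans ?_
        rw [abs_mul, abs_mul, abs_of_nonneg hA0, abs_of_nonneg hy0]
      _ ≤ |x - y| * 1 + 1 * |a n - b n| := by gcongr
      _ ≤ _ := by linarith

lemma abs_exp_sub_exp_le {x y : ℝ} (hx : x ≤ 0) (hy : y ≤ 0) :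
    |Real.exp x - Real.exp y| ≤ |x - y| := by
  wlog h : y ≤ x generalizing x y
  · rw [abs_sub_comm, abs_sub_comm x]
    exact this hy hx (le_of_not_ge h)
  rw [abs_of_nonneg (sub_nonneg.2 (Real.exp_le_exp.2 h)), abs_of_nonneg (sub_nonneg.2 h)]
  have h1 : Real.exp y = Real.exp x * Real.exp (y - x) := by rw [← Real.exp_add]; ring_nf
  have h2 := Real.add_one_le_exp (y - x)
  have h3 : Real.exp x ≤ 1 := Real.exp_le_one_iff.2 hx
  have h4 := Real.exp_pos x
  rw [h1]
  nlinarith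

lemma measurable_prod_range {Ω : Type*} [MeasurableSpace Ω] {M : Type*} [CommMonoid M]
    [MeasurableSpace M] [MeasurableMul₂ M] {X : Ω → ℕ} (hX : Measurable X) {f : ℕ → Ω → M}
    (hf : ∀ i, Measurable (f i)) : Measurable fun ω => ∏ i ∈ Finset.range (X ω), f i ω := by
  have : Measurable fun z : Ω × ℕ => ∏ i ∈ Finset.range z.2, f i z.1 :=
    measurable_from_prod_countable_left fun n =>
      Finset.measurable_fun_prod (Finset.range n) fun i _ => hf i
  exact this.comp (measurable_id.prodMk hX)

/-! ### The intensity measure -/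

/-- The measure `lam x dx` on `(0, t]`. -/
noncomputable def intensityMeasure (lam : ℝ → ℝ) (t : ℝ) : Measure ℝ :=
  (volume.restrict (Set.Ioc 0 t)).withDensity fun x => ENNReal.ofReal (lam x)

section Intensity

variable {lam : ℝ → ℝ}

lemma integrableOn_intensity (hint : ∀ t : ℝ, 0 ≤ t → IntervalIntegrable lam volume 0 t)
    {t : ℝ} (ht : 0 ≤ t) : IntegrableOn lam (Set.Ioc 0 t) :=
  (intervalIntegrable_iff_integrableOn_Ioc_of_le ht).1 (hint t ht)

lemma intensityMeasure_Iic (h0 : ∀ x, 0 ≤ x → 0 ≤ lam x)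
    (hint : ∀ t : ℝ, 0 ≤ t → IntervalIntegrable lam volume 0 t) {a t : ℝ} (ha : 0 ≤ a)
    (ht : 0 ≤ t) :
    intensityMeasure lam t (Set.Iic a) = ENNReal.ofReal (∫ x in (0 : ℝ)..(min a t), lam x) := by
  rw [intensityMeasure, withDensity_apply _ measurableSet_Iic,
    Measure.restrict_restrict measurableSet_Iic, Set.inter_comm, Set.Ioc_inter_Iic, min_comm,
    intervalIntegral.integral_of_le (le_min ha ht), ofReal_integral_eq_lintegral_ofReal]
  · exact integrableOn_intensity hint (le_min ha ht)
  · filter_upwards [ae_restrict_mem measurableSet_Ioc] with x hx using h0 x hx.1.le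

lemma intensityMeasure_univ (h0 : ∀ x, 0 ≤ x → 0 ≤ lam x)
    (hint : ∀ t : ℝ, 0 ≤ t → IntervalIntegrable lam volume 0 t) {t : ℝ} (ht : 0 ≤ t) :
    intensityMeasure lam t Set.univ = ENNReal.ofReal (∫ x in (0 : ℝ)..t, lam x) := by
  rw [intensityMeasure, withDensity_apply _ MeasurableSet.univ, Measure.restrict_univ,
    intervalIntegral.integral_of_le ht, ofReal_integral_eq_lintegral_ofReal]
  · exact integrableOn_intensity hint ht
  · filter_upwards [ae_restrict_mem measurableSet_Ioc] with x hx using h0 x hx.1.le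

lemma ae_mem_Ioc_intensityMeasure (t : ℝ) :
    ∀ᵐ x ∂(intensityMeasure lam t), x ∈ Set.Ioc 0 t :=
  (withDensity_absolutelyContinuous _ _).ae_le (ae_restrict_mem measurableSet_Ioc)

lemma integral_intensityMeasure (h0 : ∀ x, 0 ≤ x → 0 ≤ lam x)
    (hint : ∀ t : ℝ, 0 ≤ t → IntervalIntegrable lam volume 0 t) {t : ℝ} (ht : 0 ≤ t)
    (f : ℝ → ℝ) : ∫ x, f x ∂(intensityMeasure lam t) = ∫ x in (0 : ℝ)..t, f x * lam x := by
  rw [intensityMeasure, integral_withDensity_eq_integral_toReal_smul₀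
    (integrableOn_intensity hint ht).aestronglyMeasurable.aemeasurable.ennreal_ofReal
    (ae_of_all _ fun x => ENNReal.ofReal_lt_top), intervalIntegral.integral_of_le ht]
  refine setIntegral_congr_fun measurableSet_Ioc fun x hx => ?_
  rw [smul_eq_mul, ENNReal.toReal_ofReal (h0 x hx.1.le), mul_comm]

end Intensity

/-! ### Truncated arrival times and Campbell's formula -/

section Poisson

variable {Ω : Type*}

/-- The arrival times truncated at `t`, in a measurable version. -/
noncomputable def arrivalVersion (N : ℝ≥0 → Ω → ℕ) (t : ℝ≥0) (i : ℕ) (ω : Ω) : ℝ :=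
  truncArrival t i fun s => N s ω

lemma arrivalVersion_mem (N : ℝ≥0 → Ω → ℕ) (t : ℝ≥0) (i : ℕ) (ω : Ω) :
    arrivalVersion N t i ω ∈ Set.Icc (0 : ℝ) t :=
  ⟨NNReal.coe_nonneg _, NNReal.coe_le_coe.2 (truncArrival_le _ _ _)⟩

variable [MeasurableSpace Ω] {P : Measure Ω} {N : ℝ≥0 → Ω → ℕ} {lam : ℝ → ℝ}

namespace IsPoissonProcess

lemma measurable_arrivalVersion (hN : IsPoissonProcess P N lam) (t : ℝ≥0) (i : ℕ) :
    Measurable (arrivalVersion N t i) :=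
  measurable_coe_nnreal_real.comp
    ((measurable_truncArrival t i).comp (measurable_pi_lambda _ hN.measurable))

lemma hasLaw_apply (hN : IsPoissonProcess P N lam) (t : ℝ≥0) :
    HasLaw (N t) (poissonMeasure (∫ x in (0 : ℝ)..t, lam x).toNNReal) P := by
  refine (hN.law 0 t zero_le).congr ?_
  filter_upwards [hN.zero] with ω hω
  simp [hω]

lemma lintegral_natCast (hN : IsPoissonProcess P N lam) (t : ℝ≥0) :
    ∫⁻ ω, (N t ω : ℝ≥0∞) ∂P = ENNReal.ofReal (∫ x in (0 : ℝ)..t, lam x) := by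
  rw [← lintegral_map (f := fun n : ℕ => (n : ℝ≥0∞)) (by fun_prop) (hN.measurable t),
    (hN.hasLaw_apply t).map_eq, lintegral_natCast_poissonMeasure]
  rfl

/-- This expresses arrival times through counts; summed over `i`, the right side is the mean of
$N_{\min(a,t)}$, which is known. -/
lemma measure_arrivalVersion_le (hN : IsPoissonProcess P N lam) (t a : ℝ≥0) (i : ℕ) :
    P ({ω | i < N t ω} ∩ arrivalVersion N t i ⁻¹' Set.Iic a) = P {ω | i < N (min a t) ω} := by
  refine measure_congr ?_
  filter_upwards [hN.monotone, hN.rightCont] with ω hm hr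
  refine propext ⟨fun h => ?_, fun h => ?_⟩
  · have h1 : i < N t ω := h.1
    have h2 : arrivalVersion N t i ω ≤ a := h.2
    rw [arrivalVersion, truncArrival_eq hm h1, NNReal.coe_le_coe] at h2
    exact (arrival_le_iff hm hr h1).1 (le_min h2 (arrival_le_of_lt h1))
  · have h1 : i < N t ω := lt_of_lt_of_le h (hm (min_le_right a t))
    refine ⟨h1, ?_⟩
    change arrivalVersion N t i ω ≤ a
    rw [arrivalVersion, truncArrival_eq hm h1, NNReal.coe_le_coe]
    exact (arrival_le_of_lt h).trans (min_le_left _ _)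

/-- The mean measure of the points in `(0, t]` is the intensity measure. -/
lemma sum_map_arrivalVersion (hN : IsPoissonProcess P N lam) (h0 : ∀ x, 0 ≤ x → 0 ≤ lam x)
    (hint : ∀ t : ℝ, 0 ≤ t → IntervalIntegrable lam volume 0 t) (t : ℝ≥0) :
    Measure.sum (fun i => (P.restrict {ω | i < N t ω}).map (arrivalVersion N t i))
      = intensityMeasure lam t := by
  have hR := hN.measurable_arrivalVersion t
  have hfin : IsFiniteMeasure (intensityMeasure lam t) := by
    constructor
    rw [intensityMeasure_univ h0 hint t.coe_nonneg]
    exact ENNReal.ofReal_lt_top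
  -- Half-lines determine a measure once one side is known to be finite; here that side is the
  -- intensity measure.
  refine (Measure.ext_of_Iic _ _ fun a => ?_).symm
  rw [Measure.sum_apply _ measurableSet_Iic]
  have happ : ∀ i, (P.restrict {ω | i < N t ω}).map (arrivalVersion N t i) (Set.Iic a)
      = P ({ω | i < N t ω} ∩ arrivalVersion N t i ⁻¹' Set.Iic a) := by
    intro i
    rw [Measure.map_apply (hR i) measurableSet_Iic,
      Measure.restrict_apply (hR i measurableSet_Iic), Set.inter_comm]
  simp_rw [happ]
  rcases lt_or_ge a 0 with ha | ha
  · have h1 : ∀ i, {ω | i < N t ω} ∩ arrivalVersion N t i ⁻¹' Set.Iic a = ∅ := by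
      intro i
      ext ω
      have := (arrivalVersion_mem N t i ω).1
      simp only [Set.mem_inter_iff, Set.mem_preimage, Set.mem_Iic, Set.mem_empty_iff_false,
        iff_false, not_and, not_le]
      intro _
      linarith
    simp only [h1, measure_empty, tsum_zero]
    refine measure_mono_null (t := {x | ¬ x ∈ Set.Ioc 0 (t : ℝ)}) ?_
      (ae_iff.1 (ae_mem_Ioc_intensityMeasure (lam := lam) (t : ℝ)))
    intro x hx hx'
    exact absurd hx'.1 (not_lt.2 ((Set.mem_Iic.1 hx).trans ha.le))
  · lift a to ℝ≥0 using ha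
    simp_rw [hN.measure_arrivalVersion_le t a]
    rw [tsum_measure_lt_eq_lintegral P (hN.measurable _), hN.lintegral_natCast,
      intensityMeasure_Iic h0 hint a.coe_nonneg t.coe_nonneg, NNReal.coe_min]

/-- Campbell's formula for the expectation of a sum over the points in `(0, t]`. -/
theorem lintegral_sum_arrivalVersion (hN : IsPoissonProcess P N lam)
    (h0 : ∀ x, 0 ≤ x → 0 ≤ lam x)
    (hint : ∀ t : ℝ, 0 ≤ t → IntervalIntegrable lam volume 0 t) (t : ℝ≥0)
    {f : ℝ → ℝ≥0∞} (hf : Measurable f) :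
    ∫⁻ ω, ∑ i ∈ Finset.range (N t ω), f (arrivalVersion N t i ω) ∂P
      = ∫⁻ x, f x ∂(intensityMeasure lam t) := by
  have hms : ∀ i, MeasurableSet {ω | i < N t ω} :=
    fun i => measurableSet_lt measurable_const (hN.measurable t)
  have hR := hN.measurable_arrivalVersion t
  rw [← hN.sum_map_arrivalVersion h0 hint t, lintegral_sum_measure]
  have h1 : ∀ ω, ∑ i ∈ Finset.range (N t ω), f (arrivalVersion N t i ω)
      = ∑' i, {ω | i < N t ω}.indicator (fun ω => f (arrivalVersion N t i ω)) ω := by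
    intro ω
    rw [tsum_eq_sum (s := Finset.range (N t ω)) (by intro i hi; simp at hi; simp [hi])]
    refine Finset.sum_congr rfl fun i hi => ?_
    rw [Set.indicator_of_mem (by simpa using hi)]
  simp_rw [h1]
  have h2 : ∀ i, Measurable ({ω | i < N t ω}.indicator fun ω => f (arrivalVersion N t i ω)) :=
    fun i => (hf.comp (hR i)).indicator (hms i)
  rw [lintegral_tsum fun i => (h2 i).aemeasurable]
  refine tsum_congr fun i => ?_
  rw [lintegral_indicator (hms i), lintegral_map hf (hR i)]

end IsPoissonProcess

end Poisson

/-! ### The probability generating functional of a Poisson process -/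

section GeneratingFunctional

variable {Ω : Type*} {N : ℝ≥0 → Ω → ℕ}

/-- For a function constant on the cells of a grid, the product over the points reduces to the
increments. -/
lemma prod_step_arrivalVersion {ω : Ω} (hm : Monotone fun t => N t ω)
    (hr : ∀ t, ContinuousWithinAt (fun u => N u ω) (Set.Ici t) t) (hz : N 0 ω = 0)
    {δ : ℝ≥0} (hδ : 0 < δ) {t : ℝ≥0} (g : ℝ → ℝ) (m : ℕ) (hmt : m * δ ≤ t) :
    ∏ i ∈ Finset.range (N (m * δ) ω), g (⌈arrivalVersion N t i ω / δ⌉₊ * δ)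
      = ∏ k ∈ Finset.range m,
        g ((k + 1 : ℕ) * δ) ^ (N ((k + 1 : ℕ) * δ) ω - N (k * δ) ω) := by
  induction m with
  | zero => simp [hz]
  | succ m ih =>
    have hstep : (m : ℝ≥0) * δ ≤ (m + 1 : ℕ) * δ := by gcongr; simp
    rw [Finset.prod_range_succ, ← ih (hstep.trans hmt),
      ← Finset.prod_range_mul_prod_Ico _ (hm hstep)]
    congr 1
    rw [← Nat.card_Ico, ← Finset.prod_const]
    refine Finset.prod_congr rfl fun i hi => ?_
    rw [Finset.mem_Ico] at hi
    have hit : i < N t ω := hi.2.trans_le (hm hmt)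
    have h1 : (m : ℝ≥0) * δ < arrival N i ω := by
      rw [← not_le, arrival_le_iff hm hr hit, not_lt]
      exact hi.1
    have h2 : arrival N i ω ≤ (m + 1 : ℕ) * δ := arrival_le_of_lt hi.2
    -- Rounding up fits the cells $(m\delta,(m+1)\delta]$, whose points are exactly those counted by
    -- the increment of `N`.
    have h3 : ⌈(arrival N i ω : ℝ) / δ⌉₊ = m + 1 := by
      have hδ' : (0 : ℝ) < δ := hδ
      rw [Nat.ceil_eq_iff (Nat.succ_ne_zero m)]
      constructor
      · rw [lt_div_iff₀ hδ']
        exact_mod_cast h1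
      · rw [div_le_iff₀ hδ']
        exact_mod_cast h2
    rw [arrivalVersion, truncArrival_eq hm hit, h3]

variable [MeasurableSpace Ω] {P : Measure Ω} {lam : ℝ → ℝ}

lemma isFiniteMeasure_intensityMeasure (h0 : ∀ x, 0 ≤ x → 0 ≤ lam x)
    (hint : ∀ t : ℝ, 0 ≤ t → IntervalIntegrable lam volume 0 t) (t : ℝ≥0) :
    IsFiniteMeasure (intensityMeasure lam t) := by
  constructor
  rw [intensityMeasure_univ h0 hint t.coe_nonneg]
  exact ENNReal.ofReal_lt_top

lemma integrable_intensityMeasure_of_mem_Icc {t : ℝ≥0} [IsFiniteMeasure (intensityMeasure lam t)]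
    {h : ℝ → ℝ} (hm : Measurable h) (h01 : ∀ x ∈ Set.Icc (0 : ℝ) t, h x ∈ Set.Icc (0 : ℝ) 1) :
    Integrable h (intensityMeasure lam t) := by
  refine Integrable.of_bound hm.aestronglyMeasurable 1 ?_
  filter_upwards [ae_mem_Ioc_intensityMeasure (lam := lam) (t : ℝ)] with x hx
  have := h01 x ⟨hx.1.le, hx.2⟩
  rw [Real.norm_eq_abs, abs_of_nonneg this.1]
  exact this.2

namespace IsPoissonProcess

/-- Independence turns the expectation into a product of generating functions of Poisson variables.
-/
lemma integral_prod_pow_increments (hN : IsPoissonProcess P N lam)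
    (h0 : ∀ x, 0 ≤ x → 0 ≤ lam x) {t : ℕ → ℝ≥0} (ht : Monotone t) (c : ℕ → ℝ) (n : ℕ) :
    ∫ ω, ∏ k ∈ Finset.range n, c k ^ (N (t (k + 1)) ω - N (t k) ω) ∂P
      = Real.exp (∑ k ∈ Finset.range n, (c k - 1) * ∫ x in (t k : ℝ)..(t (k + 1)), lam x) := by
  have hind : iIndepFun (fun (k : Fin n) ω => N (t (k + 1)) ω - N (t k) ω) P :=
    (hN.indepIncrements.nat ht).precomp Fin.val_injective
  have hprod := hind.integral_fun_prod_comp (f := fun (k : Fin n) (m : ℕ) => c k ^ m)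
    (fun k => ((hN.measurable _).sub (hN.measurable _)).aemeasurable)
    (fun k => Measurable.of_discrete.aestronglyMeasurable)
  simp_rw [Finset.prod_range, hprod, Real.exp_sum]
  rw [Finset.prod_range]
  refine Finset.prod_congr rfl fun k _ => ?_
  have hle : t k ≤ t (k + 1) := ht (Nat.le_succ _)
  have hlaw := hN.law _ _ hle
  rw [← integral_map (f := fun m : ℕ => c k ^ m) hlaw.aemeasurable
    Measurable.of_discrete.aestronglyMeasurable, hlaw.map_eq, integral_pow_poissonMeasure,
    Real.coe_toNNReal]
  exact intervalIntegral.integral_nonneg (NNReal.coe_le_coe.2 hle)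
    fun x hx => h0 x ((NNReal.coe_nonneg _).trans hx.1)

lemma sum_integral_step {g : ℝ → ℝ} (hint : ∀ t : ℝ, 0 ≤ t → IntervalIntegrable lam volume 0 t)
    {δ : ℝ} (hδ : 0 < δ) (n : ℕ) :
    ∫ x in (0 : ℝ)..(n * δ), (g (⌈x / δ⌉₊ * δ) - 1) * lam x
      = ∑ k ∈ Finset.range n, (g ((k + 1 : ℕ) * δ) - 1)
          * ∫ x in ((k : ℝ) * δ)..((k + 1 : ℕ) * δ), lam x := by
  have hle : ∀ k : ℕ, (k : ℝ) * δ ≤ (k + 1 : ℕ) * δ := fun k => by gcongr; simp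
  have hlam : ∀ k : ℕ, IntervalIntegrable lam volume ((k : ℝ) * δ) ((k + 1 : ℕ) * δ) :=
    fun k => (hint _ (by positivity)).symm.trans (hint _ (by positivity))
  have hcell : ∀ k : ℕ, ∀ x ∈ Set.Ioc ((k : ℝ) * δ) ((k + 1 : ℕ) * δ),
      (g (⌈x / δ⌉₊ * δ) - 1) * lam x = (g ((k + 1 : ℕ) * δ) - 1) * lam x := by
    intro k x hx
    have h3 : ⌈x / δ⌉₊ = k + 1 := by
      rw [Nat.ceil_eq_iff (Nat.succ_ne_zero k)]
      constructor
      · rw [lt_div_iff₀ hδ]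
        simpa using hx.1
      · rw [div_le_iff₀ hδ]
        exact hx.2
    rw [h3]
  have hii : ∀ k : ℕ, IntervalIntegrable (fun x => (g (⌈x / δ⌉₊ * δ) - 1) * lam x) volume
      ((k : ℝ) * δ) ((k + 1 : ℕ) * δ) := by
    intro k
    refine ((hlam k).const_mul (g ((k + 1 : ℕ) * δ) - 1)).congr ?_
    rw [Set.uIoc_of_le (hle k)]
    intro x hx
    exact (hcell k x hx).symm
  have hsum := intervalIntegral.sum_integral_adjacent_intervals
    (a := fun k : ℕ => (k : ℝ) * δ) (n := n) fun k _ => hii k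
  rw [Nat.cast_zero, zero_mul] at hsum
  rw [← hsum]
  refine Finset.sum_congr rfl fun k _ => ?_
  rw [← intervalIntegral.integral_const_mul, intervalIntegral.integral_of_le (hle k),
    intervalIntegral.integral_of_le (hle k)]
  exact setIntegral_congr_fun measurableSet_Ioc (hcell k)

lemma integral_prod_step (hN : IsPoissonProcess P N lam) (h0 : ∀ x, 0 ≤ x → 0 ≤ lam x)
    (hint : ∀ t : ℝ, 0 ≤ t → IntervalIntegrable lam volume 0 t) {δ : ℝ≥0} (hδ : 0 < δ) (n : ℕ)
    (g : ℝ → ℝ) :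
    ∫ ω, ∏ i ∈ Finset.range (N (n * δ) ω), g (⌈arrivalVersion N (n * δ) i ω / δ⌉₊ * δ) ∂P
      = Real.exp (∫ x, (g (⌈x / δ⌉₊ * δ) - 1)
          ∂(intensityMeasure lam ((n * δ : ℝ≥0) : ℝ))) := by
  have hmono : Monotone fun k : ℕ => (k : ℝ≥0) * δ := fun a b hab => by
    change (a : ℝ≥0) * δ ≤ b * δ
    gcongr
  have h1 := hN.integral_prod_pow_increments h0 hmono (fun k => g ((k + 1 : ℕ) * δ)) n
  have h2 : (fun ω => ∏ i ∈ Finset.range (N (n * δ) ω),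
      g (⌈arrivalVersion N (n * δ) i ω / δ⌉₊ * δ)) =ᵐ[P] fun ω => ∏ k ∈ Finset.range n,
        g ((k + 1 : ℕ) * δ) ^ (N ((k + 1 : ℕ) * δ) ω - N (k * δ) ω) := by
    filter_upwards [hN.monotone, hN.rightCont, hN.zero] with ω hm hr hz
    exact prod_step_arrivalVersion hm hr hz hδ g n le_rfl
  rw [integral_congr_ae h2, h1, integral_intensityMeasure h0 hint (NNReal.coe_nonneg _)]
  have h3 := sum_integral_step (g := g) hint (NNReal.coe_pos.2 hδ) n
  push_cast at h3 ⊢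
  rw [h3]

lemma measurable_prod_arrivalVersion (hN : IsPoissonProcess P N lam) (t : ℝ≥0) {h : ℝ → ℝ}
    (hm : Measurable h) :
    Measurable fun ω => ∏ i ∈ Finset.range (N t ω), h (arrivalVersion N t i ω) :=
  measurable_prod_range (hN.measurable t) fun i => hm.comp (hN.measurable_arrivalVersion t i)

lemma integrable_prod_arrivalVersion [IsProbabilityMeasure P] (hN : IsPoissonProcess P N lam)
    {t : ℝ≥0} {h : ℝ → ℝ} (hm : Measurable h)
    (h01 : ∀ x ∈ Set.Icc (0 : ℝ) t, h x ∈ Set.Icc (0 : ℝ) 1) :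
    Integrable (fun ω => ∏ i ∈ Finset.range (N t ω), h (arrivalVersion N t i ω)) P := by
  refine Integrable.of_bound (hN.measurable_prod_arrivalVersion t hm).aestronglyMeasurable 1
    (ae_of_all _ fun ω => ?_)
  have hR := fun i => h01 _ (arrivalVersion_mem N t i ω)
  rw [Real.norm_eq_abs, abs_of_nonneg (Finset.prod_nonneg fun i _ => (hR i).1)]
  exact Finset.prod_le_one (fun i _ => (hR i).1) fun i _ => (hR i).2

/-- The probability generating functional is `1`-Lipschitz for the `L¹` distance of the intensity
measure. -/
lemma abs_integral_prod_sub_le [IsProbabilityMeasure P] (hN : IsPoissonProcess P N lam)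
    (h0 : ∀ x, 0 ≤ x → 0 ≤ lam x)
    (hint : ∀ t : ℝ, 0 ≤ t → IntervalIntegrable lam volume 0 t) {t : ℝ≥0} {g h : ℝ → ℝ}
    (hgm : Measurable g) (hg : ∀ x ∈ Set.Icc (0 : ℝ) t, g x ∈ Set.Icc (0 : ℝ) 1)
    (hhm : Measurable h) (hh : ∀ x ∈ Set.Icc (0 : ℝ) t, h x ∈ Set.Icc (0 : ℝ) 1) :
    |∫ ω, ∏ i ∈ Finset.range (N t ω), g (arrivalVersion N t i ω) ∂P
        - ∫ ω, ∏ i ∈ Finset.range (N t ω), h (arrivalVersion N t i ω) ∂P|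
      ≤ ∫ x, |g x - h x| ∂(intensityMeasure lam t) := by
  have := isFiniteMeasure_intensityMeasure h0 hint t
  have hnn : 0 ≤ ∫ x, |g x - h x| ∂(intensityMeasure lam t) := by positivity
  have hi : Integrable (fun x => |g x - h x|) (intensityMeasure lam t) :=
    ((integrable_intensityMeasure_of_mem_Icc hgm hg).sub
      (integrable_intensityMeasure_of_mem_Icc hhm hh)).abs
  rw [← ENNReal.ofReal_le_ofReal_iff hnn,
    ofReal_integral_eq_lintegral_ofReal hi (ae_of_all _ fun x => abs_nonneg _),
    ← hN.lintegral_sum_arrivalVersion h0 hint t (f := fun x => ENNReal.ofReal |g x - h x|)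
      (by fun_prop),
    ← integral_sub (hN.integrable_prod_arrivalVersion hgm hg)
      (hN.integrable_prod_arrivalVersion hhm hh), ← Real.norm_eq_abs, ofReal_norm]
  -- Pathwise, the difference of the products is at most the sum of $|g-h|$ over the points, whose
  -- mean is given by Campbell's formula.
  refine (enorm_integral_le_lintegral_enorm _).trans (lintegral_mono fun ω => ?_)
  rw [← ENNReal.ofReal_sum_of_nonneg fun i _ => abs_nonneg _, ← ofReal_norm,
    Real.norm_eq_abs]
  exact ENNReal.ofReal_le_ofReal (abs_prod_sub_prod_le_sum _
    (fun i _ => hg _ (arrivalVersion_mem N t i ω)) fun i _ => hh _ (arrivalVersion_mem N t i ω))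

/-- The exponents are nonpositive because `g` and `h` are at most 1, and exp is 1-Lipschitz on
$(-\infty,0]$. -/
lemma abs_exp_integral_sub_le (h0 : ∀ x, 0 ≤ x → 0 ≤ lam x)
    (hint : ∀ t : ℝ, 0 ≤ t → IntervalIntegrable lam volume 0 t) {t : ℝ≥0} {g h : ℝ → ℝ}
    (hgm : Measurable g) (hg : ∀ x ∈ Set.Icc (0 : ℝ) t, g x ∈ Set.Icc (0 : ℝ) 1)
    (hhm : Measurable h) (hh : ∀ x ∈ Set.Icc (0 : ℝ) t, h x ∈ Set.Icc (0 : ℝ) 1) :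
    |Real.exp (∫ x, (g x - 1) ∂(intensityMeasure lam t))
        - Real.exp (∫ x, (h x - 1) ∂(intensityMeasure lam t))|
      ≤ ∫ x, |g x - h x| ∂(intensityMeasure lam t) := by
  have := isFiniteMeasure_intensityMeasure h0 hint t
  have hneg : ∀ f : ℝ → ℝ, (∀ x ∈ Set.Icc (0 : ℝ) t, f x ∈ Set.Icc (0 : ℝ) 1) →
      ∫ x, (f x - 1) ∂(intensityMeasure lam t) ≤ 0 := by
    intro f hf
    refine integral_nonpos_of_ae ?_
    filter_upwards [ae_mem_Ioc_intensityMeasure (lam := lam) (t : ℝ)] with x hx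
    exact sub_nonpos.2 (hf x ⟨hx.1.le, hx.2⟩).2
  refine (abs_exp_sub_exp_le (hneg g hg) (hneg h hh)).trans ?_
  have hgi : Integrable (fun x => g x - 1) (intensityMeasure lam t) :=
    (integrable_intensityMeasure_of_mem_Icc hgm hg).sub (integrable_const 1)
  have hhi : Integrable (fun x => h x - 1) (intensityMeasure lam t) :=
    (integrable_intensityMeasure_of_mem_Icc hhm hh).sub (integrable_const 1)
  rw [← integral_sub hgi hhi]
  refine (abs_integral_le_integral_abs).trans (le_of_eq ?_)
  simp

/-- Functions satisfying the formula for the probability generating functional form a closed set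
for the `L¹` distance of the intensity measure. -/
lemma integral_prod_eq_of_approx [IsProbabilityMeasure P] (hN : IsPoissonProcess P N lam)
    (h0 : ∀ x, 0 ≤ x → 0 ≤ lam x)
    (hint : ∀ t : ℝ, 0 ≤ t → IntervalIntegrable lam volume 0 t) {t : ℝ≥0} {h : ℝ → ℝ}
    (hhm : Measurable h) (hh : ∀ x ∈ Set.Icc (0 : ℝ) t, h x ∈ Set.Icc (0 : ℝ) 1)
    (happrox : ∀ ε > 0, ∃ g : ℝ → ℝ, Measurable g ∧
      (∀ x ∈ Set.Icc (0 : ℝ) t, g x ∈ Set.Icc (0 : ℝ) 1) ∧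
      ∫ ω, ∏ i ∈ Finset.range (N t ω), g (arrivalVersion N t i ω) ∂P
        = Real.exp (∫ x, (g x - 1) ∂(intensityMeasure lam t)) ∧
      ∫ x, |g x - h x| ∂(intensityMeasure lam t) ≤ ε) :
    ∫ ω, ∏ i ∈ Finset.range (N t ω), h (arrivalVersion N t i ω) ∂P
      = Real.exp (∫ x, (h x - 1) ∂(intensityMeasure lam t)) := by
  refine eq_of_forall_dist_le fun ε hε => ?_
  obtain ⟨g, hgm, hg, hgeq, hgh⟩ := happrox (ε / 2) (by positivity)
  have e1 := hN.abs_integral_prod_sub_le h0 hint hgm hg hhm hh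
  have e2 := abs_exp_integral_sub_le h0 hint hgm hg hhm hh
  rw [hgeq] at e1
  rw [Real.dist_eq]
  rw [abs_le] at *
  constructor <;> linarith [e1.1, e1.2, e2.1, e2.2]

lemma integral_prod_eq_of_continuous [IsProbabilityMeasure P] (hN : IsPoissonProcess P N lam)
    (h0 : ∀ x, 0 ≤ x → 0 ≤ lam x)
    (hint : ∀ t : ℝ, 0 ≤ t → IntervalIntegrable lam volume 0 t) {t : ℝ≥0} {h : ℝ → ℝ}
    (hc : Continuous h) (hh : ∀ x, h x ∈ Set.Icc (0 : ℝ) 1) :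
    ∫ ω, ∏ i ∈ Finset.range (N t ω), h (arrivalVersion N t i ω) ∂P
      = Real.exp (∫ x, (h x - 1) ∂(intensityMeasure lam t)) := by
  -- The case $t=0$ is separate because the mesh $\delta=t/n$ must be positive.
  rcases eq_or_lt_of_le (zero_le : 0 ≤ t) with rfl | ht
  · have h1 : (fun ω => ∏ i ∈ Finset.range (N 0 ω), h (arrivalVersion N 0 i ω))
        =ᵐ[P] fun _ => 1 := by
      filter_upwards [hN.zero] with ω hω
      simp [hω]
    rw [integral_congr_ae h1, integral_intensityMeasure h0 hint (NNReal.coe_nonneg _)]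
    simp
  have hfin := isFiniteMeasure_intensityMeasure h0 hint t
  refine hN.integral_prod_eq_of_approx h0 hint hc.measurable (fun x _ => hh x) fun ε hε => ?_
  set C := (intensityMeasure lam t).real Set.univ + 1 with hC
  have hCpos : 0 < C := by positivity
  -- The rounded point is bounded below only by $x+\delta\le 2t$, hence the interval $[0,2t]$.
  have huc : UniformContinuousOn h (Set.Icc 0 (2 * t)) :=
    isCompact_Icc.uniformContinuousOn_of_continuous hc.continuousOn
  obtain ⟨η, hη, hηh⟩ := Metric.uniformContinuousOn_iff.1 huc (ε / C) (by positivity)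
  obtain ⟨n, hn⟩ := exists_nat_gt ((t : ℝ) / η)
  have hn0 : (0 : ℝ) < n := lt_of_le_of_lt (by positivity) hn
  have hnn : (n : ℝ≥0) ≠ 0 := by
    have : (n : ℕ) ≠ 0 := by rintro rfl; simp at hn0
    exact_mod_cast this
  have hn1 : (1 : ℝ) ≤ n := by
    have : (n : ℕ) ≠ 0 := by rintro rfl; simp at hn0
    exact_mod_cast Nat.one_le_iff_ne_zero.2 this
  set δ : ℝ≥0 := t / n with hδdef
  have hδ : 0 < δ := by positivity
  have hδ' : (0 : ℝ) < δ := hδ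
  have hnδ : (n : ℝ≥0) * δ = t := by rw [hδdef]; field_simp
  have hδη : (δ : ℝ) < η := by
    rw [hδdef]
    push_cast
    rw [div_lt_iff₀ hn0]
    rw [div_lt_iff₀ hη] at hn
    linarith
  have hδt : (δ : ℝ) ≤ t := by
    rw [hδdef]
    push_cast
    exact div_le_self t.coe_nonneg hn1
  have hstep := hN.integral_prod_step h0 hint hδ n h
  rw [hnδ] at hstep
  refine ⟨fun x => h (⌈x / δ⌉₊ * δ), ?_, fun x _ => hh _, hstep, ?_⟩
  · have hceil : Measurable fun x : ℝ => ⌈x / δ⌉₊ := Nat.measurable_ceil.comp (by fun_prop)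
    have hcast : Measurable fun k : ℕ => h (k * δ) := Measurable.of_discrete
    exact hcast.comp hceil
  · have hbound : ∀ᵐ x : ℝ ∂(intensityMeasure lam t), ‖|h (⌈x / δ⌉₊ * δ) - h x|‖ ≤ ε / C := by
      filter_upwards [ae_mem_Ioc_intensityMeasure (lam := lam) (t : ℝ)] with x hx
      have hx0 : 0 ≤ x / δ := div_nonneg hx.1.le hδ'.le
      have hlow : x ≤ ⌈x / δ⌉₊ * δ := (div_le_iff₀ hδ').1 (Nat.le_ceil _)
      have hupp : ⌈x / δ⌉₊ * δ < x + δ := by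
        have := Nat.ceil_lt_add_one hx0
        calc (⌈x / δ⌉₊ : ℝ) * δ < (x / δ + 1) * δ := by gcongr
          _ = x + δ := by field_simp
      rw [Real.norm_eq_abs, abs_abs, ← Real.dist_eq]
      refine (hηh _ ⟨hx.1.le.trans hlow, by linarith [hx.2]⟩ _
        ⟨hx.1.le, by linarith [hx.2, t.coe_nonneg]⟩ ?_).le
      rw [Real.dist_eq, abs_of_nonneg (by linarith)]
      linarith
    have hle := norm_integral_le_of_norm_le_const hbound
    calc ∫ x, |h (⌈x / δ⌉₊ * δ) - h x| ∂(intensityMeasure lam t)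
        ≤ ε / C * (intensityMeasure lam t).real Set.univ := (le_abs_self _).trans hle
      _ ≤ ε / C * C := by gcongr; linarith
      _ = ε := by field_simp

/-- The probability generating functional of a Poisson process: for measurable `h` with values in
`[0, 1]`, the expectation of the product of `h` over the points in `(0, t]` is
`exp (∫_0^t (h - 1) lam)`. -/
theorem integral_prod_eq [IsProbabilityMeasure P] (hN : IsPoissonProcess P N lam)
    (h0 : ∀ x, 0 ≤ x → 0 ≤ lam x)
    (hint : ∀ t : ℝ, 0 ≤ t → IntervalIntegrable lam volume 0 t) {t : ℝ≥0} {h : ℝ → ℝ}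
    (hm : Measurable h) (hh : ∀ x ∈ Set.Icc (0 : ℝ) t, h x ∈ Set.Icc (0 : ℝ) 1) :
    ∫ ω, ∏ i ∈ Finset.range (N t ω), h (arrivalVersion N t i ω) ∂P
      = Real.exp (∫ x, (h x - 1) ∂(intensityMeasure lam t)) := by
  have hfin := isFiniteMeasure_intensityMeasure h0 hint t
  have hhi := integrable_intensityMeasure_of_mem_Icc (lam := lam) hm hh
  refine hN.integral_prod_eq_of_approx h0 hint hm hh fun ε hε => ?_
  obtain ⟨f, hf, hfi⟩ := hhi.exists_boundedContinuous_integral_sub_le hε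
  -- Clamping the approximant to $[0,1]$ does not increase its distance to `h`, whose values on
  -- $[0,t]$ are already there.
  have hgc : Continuous fun x => max 0 (min 1 (f x)) := by fun_prop
  have hg01 : ∀ x, max 0 (min 1 (f x)) ∈ Set.Icc (0 : ℝ) 1 := fun x =>
    ⟨le_max_left _ _, max_le zero_le_one (min_le_left _ _)⟩
  refine ⟨fun x => max 0 (min 1 (f x)), hgc.measurable, fun x _ => hg01 x,
    hN.integral_prod_eq_of_continuous h0 hint hgc hg01, le_trans ?_ hf⟩
  refine integral_mono_ae ?_ (hhi.sub hfi).norm ?_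
  · exact ((integrable_intensityMeasure_of_mem_Icc hgc.measurable fun x _ => hg01 x).sub hhi).abs
  · filter_upwards [ae_mem_Ioc_intensityMeasure (lam := lam) (t : ℝ)] with x hx
    obtain ⟨ha, hb⟩ := hh x ⟨hx.1.le, hx.2⟩
    rw [Real.norm_eq_abs, abs_sub_comm]
    rcases le_total (f x) 0 with h1 | h1 <;> rcases le_total (f x) 1 with h2 | h2 <;>
      simp only [min_eq_right h2, min_eq_left h2, max_eq_left h1, max_eq_right h1,
        max_eq_right (zero_le_one' ℝ)] <;>
      rw [abs_le] <;> constructor <;> cases abs_cases (h x - f x) <;> linarith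

end IsPoissonProcess

end GeneratingFunctional

/-! ### Averaging over the increments -/

section Model

variable {Ω : Type*} [MeasurableSpace Ω] {P : Measure Ω} {N : ℝ≥0 → Ω → ℕ}
  {V : ℕ → Ω → ℝ × ℝ} {G : ℝ≥0 → Ω → ℝ} {lam p : ℝ → ℝ} {μ : Measure (ℝ × ℝ)}

/-- The product is viewed as a function of the mark sequence and the path, so that it can be
integrated against their joint law. -/
lemma measurable_prod_truncArrival (t : ℝ≥0) {k : ℝ × (ℝ × ℝ) → ℝ≥0∞} (hk : Measurable k) :
    Measurable fun z : (ℕ → ℝ × ℝ) × (ℝ≥0 → ℕ) =>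
      ∏ i ∈ Finset.range (z.2 t), k ((truncArrival t i z.2 : ℝ), z.1 i) := by
  refine measurable_prod_range ((measurable_pi_apply t).comp measurable_snd) fun i => ?_
  refine hk.comp (Measurable.prodMk ?_ ((measurable_pi_apply i).comp measurable_fst))
  exact measurable_coe_nnreal_real.comp ((measurable_truncArrival t i).comp measurable_snd)

namespace IsShockModel

lemma isProbabilityMeasure_law [IsProbabilityMeasure P] (hM : IsShockModel P N V G lam p μ) :
    IsProbabilityMeasure μ :=
  (hM.V_law 0).isProbabilityMeasure_iff.1 inferInstance

/-- The joint law of marks and path is a product. With the path frozen, the arrival times and the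
number of factors are constants, and the independent marks can be integrated one by one. -/
lemma lintegral_prod_marks [IsProbabilityMeasure P] (hM : IsShockModel P N V G lam p μ)
    (t : ℝ≥0) {k : ℝ × (ℝ × ℝ) → ℝ≥0∞} (hk : Measurable k) :
    ∫⁻ ω, ∏ i ∈ Finset.range (N t ω), k (arrivalVersion N t i ω, V i ω) ∂P
      = ∫⁻ ω, ∏ i ∈ Finset.range (N t ω), ∫⁻ v, k (arrivalVersion N t i ω, v) ∂μ ∂P := by
  have hμ := hM.isProbabilityMeasure_law
  have hVm : Measurable fun ω i => V i ω := measurable_pi_lambda _ hM.V_measurable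
  have hNm : Measurable fun ω t => N t ω := measurable_pi_lambda _ hM.poisson.measurable
  have hΨ := measurable_prod_truncArrival t hk
  have hk' : Measurable fun x => ∫⁻ v, k (x, v) ∂μ := hk.lintegral_prod_right'
  have hlaw := (indepFun_iff_map_prod_eq_prod_map_map hVm.aemeasurable hNm.aemeasurable).1
    hM.V_indep_N
  have := Measure.isProbabilityMeasure_map (μ := P) hVm.aemeasurable
  have := Measure.isProbabilityMeasure_map (μ := P) hNm.aemeasurable
  have hinner : ∀ n : ℝ≥0 → ℕ,
      ∫⁻ v, ∏ i ∈ Finset.range (n t), k ((truncArrival t i n : ℝ), v i)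
          ∂(P.map fun ω i => V i ω)
        = ∏ i ∈ Finset.range (n t), ∫⁻ v, k ((truncArrival t i n : ℝ), v) ∂μ := by
    intro n
    have hki : ∀ i : ℕ, Measurable fun v => k ((truncArrival t i n : ℝ), v) :=
      fun i => hk.comp measurable_prodMk_left
    have hsec : Measurable fun v : ℕ → ℝ × ℝ =>
        ∏ i ∈ Finset.range (n t), k ((truncArrival t i n : ℝ), v i) :=
      Finset.measurable_fun_prod _ fun i _ => (hki i).comp (measurable_pi_apply i)
    rw [lintegral_map hsec hVm]
    have hi : iIndepFun (fun i ω => k ((truncArrival t i n : ℝ), V i ω)) P :=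
      hM.V_indep.comp (fun i v => k ((truncArrival t i n : ℝ), v)) hki
    rw [lintegral_prod_eq_prod_lintegral_of_indepFun _ _ hi
      fun i => (hki i).comp (hM.V_measurable i)]
    refine Finset.prod_congr rfl fun i _ => ?_
    rw [← (hM.V_law i).map_eq, lintegral_map (hki i) (hM.V_measurable i)]
  calc ∫⁻ ω, ∏ i ∈ Finset.range (N t ω), k (arrivalVersion N t i ω, V i ω) ∂P
      = ∫⁻ z, ∏ i ∈ Finset.range (z.2 t), k ((truncArrival t i z.2 : ℝ), z.1 i)
          ∂(P.map fun ω => ((fun i => V i ω), (fun t => N t ω))) := by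
        rw [lintegral_map hΨ (hVm.prodMk hNm)]
        rfl
    _ = ∫⁻ n, ∏ i ∈ Finset.range (n t), ∫⁻ v, k ((truncArrival t i n : ℝ), v) ∂μ
          ∂(P.map fun ω t => N t ω) := by
        rw [hlaw, lintegral_prod_symm _ hΨ.aemeasurable]
        exact lintegral_congr hinner
    _ = _ := by
        refine lintegral_map (measurable_prod_range (measurable_pi_apply t) fun i => ?_) hNm
        exact hk'.comp (measurable_coe_nnreal_real.comp (measurable_truncArrival t i))

lemma ae_V_nonneg (hM : IsShockModel P N V G lam p μ) :
    ∀ᵐ ω ∂P, ∀ i, 0 ≤ (V i ω).1 ∧ 0 ≤ (V i ω).2 := by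
  rw [ae_all_iff]
  intro i
  have h := hM.V_nonneg
  rw [← (hM.V_law i).map_eq] at h
  exact ae_of_ae_map (hM.V_law i).aemeasurable h

lemma laplaceMeasure₂_eq (hM : IsShockModel P N V G lam p μ) (u s : ℝ) :
    laplaceMeasure₂ μ u s = ∫ v, Real.exp (-(u * v.1) - s * v.2) ∂μ := by
  rw [laplaceMeasure₂, Measure.restrict_eq_self_of_ae_mem]
  filter_upwards [hM.V_nonneg] with v hv using ⟨hv.1, hv.2⟩

lemma integrable_exp_marks [IsProbabilityMeasure P] (hM : IsShockModel P N V G lam p μ)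
    {u s : ℝ} (hu : 0 ≤ u) (hs : 0 ≤ s) :
    Integrable (fun v : ℝ × ℝ => Real.exp (-(u * v.1) - s * v.2)) μ := by
  have hμ := hM.isProbabilityMeasure_law
  refine Integrable.of_bound (by fun_prop) 1 ?_
  filter_upwards [hM.V_nonneg] with v hv
  rw [Real.norm_eq_abs, abs_of_nonneg (Real.exp_nonneg _), Real.exp_le_one_iff]
  have := mul_nonneg hu hv.1
  have := mul_nonneg hs hv.2
  linarith

lemma laplaceMeasure₂_mem_Icc [IsProbabilityMeasure P] (hM : IsShockModel P N V G lam p μ)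
    {u s : ℝ} (hu : 0 ≤ u) (hs : 0 ≤ s) : laplaceMeasure₂ μ u s ∈ Set.Icc (0 : ℝ) 1 := by
  have hμ := hM.isProbabilityMeasure_law
  rw [hM.laplaceMeasure₂_eq]
  refine ⟨integral_nonneg fun v => Real.exp_nonneg _, ?_⟩
  calc ∫ v, Real.exp (-(u * v.1) - s * v.2) ∂μ ≤ ∫ _, (1 : ℝ) ∂μ := by
        refine integral_mono_ae (hM.integrable_exp_marks hu hs) (integrable_const _) ?_
        filter_upwards [hM.V_nonneg] with v hv
        rw [Real.exp_le_one_iff]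
        have := mul_nonneg hu hv.1
        have := mul_nonneg hs hv.2
        linarith
    _ = 1 := by simp

lemma measurable_laplaceMeasure₂ [IsProbabilityMeasure P] (hM : IsShockModel P N V G lam p μ)
    (s : ℝ) : Measurable fun u => laplaceMeasure₂ μ u s := by
  have hμ := hM.isProbabilityMeasure_law
  have hm : StronglyMeasurable fun z : ℝ × (ℝ × ℝ) =>
      Real.exp (-(z.1 * z.2.1) - s * z.2.2) := by
    refine Measurable.stronglyMeasurable ?_
    fun_prop
  simp_rw [hM.laplaceMeasure₂_eq]
  exact hm.integral_prod_right'.measurable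

/-- The constant 1 integrates to $\Lambda(t)$ and the remaining term is the convolution. -/
lemma exp_integral_intensityMeasure [IsProbabilityMeasure P]
    (hM : IsShockModel P N V G lam p μ) (t : ℝ≥0) {s : ℝ}
    (hmem : ∀ x ∈ Set.Icc (0 : ℝ) t,
      (1 - p x) * laplaceMeasure₂ μ (t - x) s ∈ Set.Icc (0 : ℝ) 1)
    (hmeas : Measurable fun x : ℝ => (1 - p x) * laplaceMeasure₂ μ (t - x) s) :
    Real.exp (∫ x, ((1 - p x) * laplaceMeasure₂ μ (t - x) s - 1) ∂(intensityMeasure lam t))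
      = nuTilde lam p μ t s := by
  have := isFiniteMeasure_intensityMeasure hM.lam_nonneg hM.lam_integrable t
  rw [integral_sub (integrable_intensityMeasure_of_mem_Icc hmeas hmem) (integrable_const _),
    integral_intensityMeasure hM.lam_nonneg hM.lam_integrable t.coe_nonneg,
    integral_intensityMeasure hM.lam_nonneg hM.lam_integrable t.coe_nonneg, nuTilde, convFun,
    cumIntensity]
  simp only [one_mul]
  congr 1
  rw [sub_eq_neg_add]
  congr 1
  refine intervalIntegral.integral_congr fun x _ => ?_
  simp only [qlam]
  ring

/-- The Laplace functional of the marked points. -/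
lemma lintegral_prod_ofReal [IsProbabilityMeasure P] (hM : IsShockModel P N V G lam p μ)
    (t : ℝ≥0) {s : ℝ} (hs : 0 ≤ s) :
    ∫⁻ ω, ∏ i ∈ Finset.range (N t ω), ENNReal.ofReal ((1 - p (arrivalVersion N t i ω))
        * Real.exp (-((t - arrivalVersion N t i ω) * (V i ω).1) - s * (V i ω).2)) ∂P
      = ENNReal.ofReal (nuTilde lam p μ t s) := by
  have hq : ∀ x ∈ Set.Icc (0 : ℝ) t, 1 - p x ∈ Set.Icc (0 : ℝ) 1 := fun x hx => by
    have := hM.p_mem x hx.1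
    exact ⟨by linarith [this.2], by linarith [this.1]⟩
  have hmem : ∀ x ∈ Set.Icc (0 : ℝ) t,
      (1 - p x) * laplaceMeasure₂ μ (t - x) s ∈ Set.Icc (0 : ℝ) 1 := fun x hx => by
    have h1 := hM.laplaceMeasure₂_mem_Icc (sub_nonneg.2 hx.2) hs
    exact ⟨mul_nonneg (hq x hx).1 h1.1, mul_le_one₀ (hq x hx).2 h1.1 h1.2⟩
  have hpm := hM.p_measurable
  have hmeas : Measurable fun x : ℝ => (1 - p x) * laplaceMeasure₂ μ (t - x) s :=
    (measurable_const.sub hpm).mul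
      ((hM.measurable_laplaceMeasure₂ s).comp (measurable_const.sub measurable_id))
  have hk : Measurable fun z : ℝ × (ℝ × ℝ) => ENNReal.ofReal ((1 - p z.1)
      * Real.exp (-((t - z.1) * z.2.1) - s * z.2.2)) := by fun_prop
  rw [hM.lintegral_prod_marks t hk, ← hM.exp_integral_intensityMeasure t hmem hmeas,
    ← hM.poisson.integral_prod_eq hM.lam_nonneg hM.lam_integrable hmeas hmem,
    ofReal_integral_eq_lintegral_ofReal (hM.poisson.integrable_prod_arrivalVersion hmeas hmem)
      (ae_of_all _ fun ω => Finset.prod_nonneg fun i _ => (hmem _ (arrivalVersion_mem N t i ω)).1)]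
  refine lintegral_congr fun ω => ?_
  rw [ENNReal.ofReal_prod_of_nonneg fun i _ => (hmem _ (arrivalVersion_mem N t i ω)).1]
  refine Finset.prod_congr rfl fun i _ => ?_
  have hx := arrivalVersion_mem N t i ω
  set x := arrivalVersion N t i ω
  rw [hM.laplaceMeasure₂_eq, ← integral_const_mul, ofReal_integral_eq_lintegral_ofReal
    ((hM.integrable_exp_marks (sub_nonneg.2 hx.2) hs).const_mul _)
    (ae_of_all _ fun v => mul_nonneg (hq x hx).1 (Real.exp_nonneg _))]

end IsShockModel

/-! ### The measure `ν_t` -/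

/-- The weight `exp(-∫_0^t A_s⁽¹⁾ ds) ∏_{i ≤ N_t} q(T_i)`, in a measurable version. -/
noncomputable def shockWeight (N : ℝ≥0 → Ω → ℕ) (V : ℕ → Ω → ℝ × ℝ) (p : ℝ → ℝ) (t : ℝ≥0)
    (ω : Ω) : ℝ :=
  ∏ i ∈ Finset.range (N t ω), ((1 - p (arrivalVersion N t i ω))
    * Real.exp (-((t - arrivalVersion N t i ω) * (V i ω).1)))

/-- The law of `A_t⁽²⁾` under the measure with density `shockWeight`. -/
noncomputable def shockMeasure (P : Measure Ω) (N : ℝ≥0 → Ω → ℕ) (V : ℕ → Ω → ℝ × ℝ)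
    (p : ℝ → ℝ) (t : ℝ≥0) : Measure ℝ :=
  (P.withDensity fun ω => ENNReal.ofReal (shockWeight N V p t ω)).map
    fun ω => (compound N V t ω).2

namespace IsShockModel

lemma measurable_compound_snd (hM : IsShockModel P N V G lam p μ) (t : ℝ≥0) :
    Measurable fun ω => (compound N V t ω).2 := by
  have : Measurable fun z : Ω × ℕ => ∑ i ∈ Finset.range z.2, V i z.1 :=
    measurable_from_prod_countable_left fun n =>
      Finset.measurable_fun_sum (Finset.range n) fun i _ => hM.V_measurable i
  exact measurable_snd.comp (this.comp (measurable_id.prodMk (hM.poisson.measurable t)))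

lemma measurable_shockWeight (hM : IsShockModel P N V G lam p μ) (t : ℝ≥0) :
    Measurable (shockWeight N V p t) := by
  refine measurable_prod_range (hM.poisson.measurable t) fun i => ?_
  have h1 := hM.poisson.measurable_arrivalVersion t i
  have h2 := hM.V_measurable i
  have h3 := hM.p_measurable
  fun_prop

lemma shockWeight_nonneg (hM : IsShockModel P N V G lam p μ) (t : ℝ≥0) (ω : Ω) :
    0 ≤ shockWeight N V p t ω :=
  Finset.prod_nonneg fun i _ => mul_nonneg
    (sub_nonneg.2 (hM.p_mem _ (arrivalVersion_mem N t i ω).1).2) (Real.exp_nonneg _)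

lemma shockWeight_le_one (hM : IsShockModel P N V G lam p μ) (t : ℝ≥0) :
    ∀ᵐ ω ∂P, shockWeight N V p t ω ≤ 1 := by
  filter_upwards [hM.ae_V_nonneg] with ω hV
  have hR := arrivalVersion_mem N t (ω := ω)
  have hp := fun i => hM.p_mem _ (hR i).1
  refine Finset.prod_le_one (fun i _ => mul_nonneg (sub_nonneg.2 (hp i).2) (Real.exp_nonneg _))
    fun i _ => mul_le_one₀ (by linarith [(hp i).1]) (Real.exp_nonneg _) ?_
  rw [Real.exp_le_one_iff, neg_nonpos]
  exact mul_nonneg (sub_nonneg.2 (hR i).2) (hV i).1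

lemma isFiniteMeasure_shockMeasure [IsProbabilityMeasure P]
    (hM : IsShockModel P N V G lam p μ) (t : ℝ≥0) : IsFiniteMeasure (shockMeasure P N V p t) := by
  have : IsFiniteMeasure (P.withDensity fun ω => ENNReal.ofReal (shockWeight N V p t ω)) := by
    refine isFiniteMeasure_withDensity_ofReal (Integrable.of_bound
      (hM.measurable_shockWeight t).aestronglyMeasurable 1 ?_).2
    filter_upwards [hM.shockWeight_le_one t] with ω hω
    rwa [Real.norm_eq_abs, abs_of_nonneg (hM.shockWeight_nonneg t ω)]
  exact Measure.isFiniteMeasure_map _ _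

lemma shockMeasure_Iio (hM : IsShockModel P N V G lam p μ) (t : ℝ≥0) :
    shockMeasure P N V p t (Set.Iio 0) = 0 := by
  rw [shockMeasure, Measure.map_apply (hM.measurable_compound_snd t) measurableSet_Iio]
  refine withDensity_absolutelyContinuous _ _ ?_
  refine measure_mono_null ?_ (ae_iff.1 hM.ae_V_nonneg)
  intro ω hω hV
  have : 0 ≤ (compound N V t ω).2 := by
    rw [compound, Prod.snd_sum]
    exact Finset.sum_nonneg fun i _ => (hV i).2
  exact absurd hω (not_lt.2 this)

lemma integral_shockMeasure (hM : IsShockModel P N V G lam p μ) (t : ℝ≥0) {f : ℝ → ℝ}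
    (hf : Measurable f) :
    ∫ x, f x ∂(shockMeasure P N V p t)
      = ∫ ω, f (compound N V t ω).2 * shockWeight N V p t ω ∂P := by
  rw [shockMeasure, integral_map (hM.measurable_compound_snd t).aemeasurable
    hf.aestronglyMeasurable, integral_withDensity_eq_integral_toReal_smul
    (hM.measurable_shockWeight t).ennreal_ofReal (ae_of_all _ fun _ => ENNReal.ofReal_lt_top)]
  refine integral_congr_ae (ae_of_all _ fun ω => ?_)
  simp only [smul_eq_mul]
  rw [ENNReal.toReal_ofReal (hM.shockWeight_nonneg t ω), mul_comm]

/-- The factor $e^{-sA_t^{(2)}}$ is distributed over the shocks and joined to the weight, which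
reduces the claim to the Laplace functional of the marked points. -/
lemma laplaceMeasure_shockMeasure [IsProbabilityMeasure P] (hM : IsShockModel P N V G lam p μ)
    (t : ℝ≥0) {s : ℝ} (hs : 0 ≤ s) :
    laplaceMeasure (shockMeasure P N V p t) s = nuTilde lam p μ t s := by
  rw [laplaceMeasure, restrict_Ici_eq_self (hM.shockMeasure_Iio t),
    hM.integral_shockMeasure t (by fun_prop), integral_eq_lintegral_of_nonneg_ae
      (ae_of_all _ fun ω => mul_nonneg (Real.exp_nonneg _) (hM.shockWeight_nonneg t ω))]
  · have h := hM.lintegral_prod_ofReal t hs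
    have hcongr : ∀ ω, ENNReal.ofReal (Real.exp (-(s * (compound N V t ω).2))
        * shockWeight N V p t ω) = ∏ i ∈ Finset.range (N t ω),
        ENNReal.ofReal ((1 - p (arrivalVersion N t i ω))
          * Real.exp (-((t - arrivalVersion N t i ω) * (V i ω).1) - s * (V i ω).2)) := by
      intro ω
      rw [← ENNReal.ofReal_prod_of_nonneg fun i _ => mul_nonneg
        (sub_nonneg.2 (hM.p_mem _ (arrivalVersion_mem N t i ω).1).2) (Real.exp_nonneg _)]
      congr 1
      rw [compound, Prod.snd_sum, Finset.mul_sum, ← Finset.sum_neg_distrib, Real.exp_sum,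
        shockWeight, ← Finset.prod_mul_distrib]
      refine Finset.prod_congr rfl fun i _ => ?_
      rw [mul_left_comm, ← Real.exp_add]
      ring_nf
    simp_rw [hcongr, h]
    exact ENNReal.toReal_ofReal (Real.exp_nonneg _)
  · refine Measurable.aestronglyMeasurable (Measurable.mul ?_ (hM.measurable_shockWeight t))
    have := hM.measurable_compound_snd t
    fun_prop

lemma hasLaplaceTransform_shockMeasure [IsProbabilityMeasure P]
    (hM : IsShockModel P N V G lam p μ) (t : ℝ≥0) :
    HasLaplaceTransform (shockMeasure P N V p t) (nuTilde lam p μ t) where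
  finite := hM.isFiniteMeasure_shockMeasure t
  support := hM.shockMeasure_Iio t
  eq _ hs := hM.laplaceMeasure_shockMeasure t hs

lemma shockWeight_eq (hM : IsShockModel P N V G lam p μ) (t : ℝ≥0) :
    ∀ᵐ ω ∂P, shockWeight N V p t ω
      = Real.exp (-∫ s in (0 : ℝ)..t, (compound N V s.toNNReal ω).1)
        * ∏ i ∈ Finset.range (N t ω), (1 - p (arrival N i ω)) := by
  filter_upwards [hM.poisson.monotone, hM.poisson.rightCont] with ω hm hr
  rw [integral_compound_fst hm hr, ← Finset.sum_neg_distrib, Real.exp_sum, shockWeight,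
    ← Finset.prod_mul_distrib]
  refine Finset.prod_congr rfl fun i hi => ?_
  rw [arrivalVersion, truncArrival_eq hm (Finset.mem_range.1 hi), mul_comm, mul_comm (V i ω).1]

lemma phi_eq_integral_shockMeasure (hM : IsShockModel P N V G lam p μ) (t : ℝ≥0) (L : ℝ) :
    phi P N V G p t L = ∫ x, cdf (P.map (G t)) (L - x) ∂(shockMeasure P N V p t) := by
  have hF : Measurable fun x => cdf (P.map (G t)) x := (monotone_cdf _).measurable
  rw [hM.integral_shockMeasure t (f := fun x => cdf (P.map (G t)) (L - x))
    (hF.comp (measurable_const.sub measurable_id)), phi]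
  refine integral_congr_ae ?_
  filter_upwards [hM.shockWeight_eq t] with ω hω
  rw [hω, mul_assoc]

/-- This vanishing restricts the convolution integral to $[0,L]$ and permits the translation
argument for the Laplace transform. -/
lemma cdf_eq_zero_of_neg [IsProbabilityMeasure P] (hM : IsShockModel P N V G lam p μ) (t : ℝ≥0)
    {x : ℝ} (hx : x < 0) : cdf (P.map (G t)) x = 0 := by
  have := Measure.isProbabilityMeasure_map (μ := P) (hM.G_measurable t).aemeasurable
  rw [cdf_eq_real, measureReal_eq_zero_iff,
    Measure.map_apply (hM.G_measurable t) measurableSet_Iic]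
  refine measure_mono_null ?_ (ae_iff.1 hM.G_nonneg)
  intro ω hω hG
  exact absurd (hG t) (not_le.2 (lt_of_le_of_lt hω hx))

end IsShockModel

lemma integral_eq_convMeasure {F : ℝ → ℝ} (hF : ∀ x < 0, F x = 0) {ν : Measure ℝ}
    (hν : ν (Set.Iio 0) = 0) (L : ℝ) : ∫ x, F (L - x) ∂ν = convMeasure F ν L := by
  rw [convMeasure, ← integral_indicator measurableSet_Icc]
  refine integral_congr_ae ?_
  filter_upwards [ae_nonneg_of_measure_Iio hν] with x hx
  by_cases hxL : x ≤ L
  · rw [Set.indicator_of_mem (Set.mem_Icc.2 ⟨hx, hxL⟩)]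
  · rw [Set.indicator_of_notMem fun h => hxL h.2, hF _ (by linarith)]

end Model

end ShockModel

/-! ### The main theorem -/

theorem mainTheorem5 {Ω : Type*} [MeasurableSpace Ω] (P : Measure Ω) [IsProbabilityMeasure P]
    (N : ℝ≥0 → Ω → ℕ) (V : ℕ → Ω → ℝ × ℝ) (G : ℝ≥0 → Ω → ℝ) (lam p : ℝ → ℝ)
    (μ : Measure (ℝ × ℝ)) (hM : ShockModel.IsShockModel P N V G lam p μ) (t : ℝ≥0) :
    -- the Laplace transform in `L` factorizes
    (∀ s : ℝ, 0 ≤ s →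
      ShockModel.laplaceFun (ShockModel.phi P N V G p t) s =
        ShockModel.laplaceFun (fun x => cdf (P.map (G t)) x) s
          * ENNReal.ofReal (ShockModel.nuTilde lam p μ t s)) ∧
    -- there is exactly one measure `ν_t` with the given Laplace transform
    (∃! ν : Measure ℝ, ShockModel.HasLaplaceTransform ν (ShockModel.nuTilde lam p μ t)) ∧
    -- and `φ_t = F_{G_t} * ν_t`
    (∀ ν : Measure ℝ, ShockModel.HasLaplaceTransform ν (ShockModel.nuTilde lam p μ t) →
      ∀ L : ℝ, 0 ≤ L →
        ShockModel.phi P N V G p t L =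
          ShockModel.convMeasure (fun x => cdf (P.map (G t)) x) ν L) ∧
    -- the case of independent `V⁽¹⁾`, `V⁽²⁾`
    (IndepFun (Prod.fst : ℝ × ℝ → ℝ) Prod.snd μ →
      ∀ s : ℝ, 0 ≤ s →
        ShockModel.nuTilde lam p μ t s =
          Real.exp (-ShockModel.cumIntensity lam t
            + ShockModel.aFun lam p μ t * ShockModel.laplaceMeasure (μ.map Prod.snd) s)) := by
  have hν := hM.hasLaplaceTransform_shockMeasure t
  have hfin := hν.finite
  have huniq : ∀ ν, ShockModel.HasLaplaceTransform ν (ShockModel.nuTilde lam p μ t) →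
      ν = ShockModel.shockMeasure P N V p t := by
    intro ν h
    have := h.finite
    exact ShockModel.measure_ext_of_laplaceMeasure_eq h.support hν.support fun k =>
      (h.eq k k.cast_nonneg).trans (hν.eq k k.cast_nonneg).symm
  refine ⟨fun s hs => ?_, ⟨_, hν, huniq⟩, fun ν h L _ => ?_, fun h s _ =>
    ShockModel.nuTilde_eq_of_indepFun h lam p t s⟩
  · rw [← hν.eq s hs]
    exact ShockModel.laplaceFun_convolution (monotone_cdf _).measurable (fun x => cdf_nonneg _ x)
      (fun x hx => hM.cdf_eq_zero_of_neg t hx) (fun x => cdf_le_one _ x) hν.support hs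
      fun L _ => hM.phi_eq_integral_shockMeasure t L
  · rw [huniq ν h, hM.phi_eq_integral_shockMeasure t L]
    exact ShockModel.integral_eq_convMeasure (fun x hx => hM.cdf_eq_zero_of_neg t hx)
      hν.support L
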